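/- Let $\lambda>0$ and let $\mu:[0,\infty)\to[0,\infty)$ be measurable with $\hat\mu:=\int_0^\infty\mu(s)\,ds<1$. Let $N(t)$, $t\ge 0$, be a one-dimensional Hawkes process with background intensity $\lambda$ and response function $\mu$: a counting process (its paths are finite, nondecreasing, right-continuous step functions with $N(0)=0$ and increments of size $+1$) whose intensity with respect to its natural filtration is $$\lambda(t)=\lambda+\int_0^t\mu(t-s)\,dN(s),$$ that is, $N(t)-\int_0^t\lambda(s)\,ds$ is a local martingale in the natural filtration of $N$. Let $(X_k)_{k\ge 0}$ be a Markov chain, independent of $N$, with finite state space $\{1,\dots,d\}$, irreducible transition matrix $P(i,j)=\mathbb P(X_{k+1}=j\mid X_k=i)$, stationary distribution $\pi^*=(\pi^*_1,\dots,\pi^*_d)$ and arbitrary initial distribution. Let $a:\{1,\dots,d\}\to\mathbb R$, let $S_0$ be a real random variable, and put $$S_t=S_0+\sum_{k=1}^{N(t)}a(X_k),\qquad \hat a^*=\sum_{i=1}^d\pi^*_i\,a(i).$$ Then, as $n\to\infty$, the processes $\big(S_{nt}/n\big)_{t\ge0}$ converge weakly in $D[0,\infty)$ with the Skorokhod $J_1$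 topology to the deterministic process $$\Big(\hat a^*\,\frac{\lambda}{1-\hat\mu}\,t\Big)_{t\ge0}.$$ -/

import Mathlib

open MeasureTheory ProbabilityTheory Filter Topology
open scoped NNReal Matrix

/-! ### The Skorokhod space `D[0, ∞)` -/

/-- Right-continuous functions on `[0, ∞)` with left limits. -/
structure IsCadlag (f : ℝ≥0 → ℝ) : Prop where
  rightCont : ∀ t, ContinuousWithinAt f (Set.Ici t) t
  leftLim : ∀ t, ∃ l, Tendsto f (𝓝[<] t) (𝓝 l)

/-- The space `D[0, ∞)` of real càdlàg functions. -/
def SkorokhodSpace : Type := {f : ℝ≥0 → ℝ // IsCadlag f}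

namespace SkorokhodSpace

/-- The paths `g` for which there is a time change `α` (an increasing bijection of `[0, ∞)`) that
moves every point by less than `ε` and for which `g ∘ α` is within `ε` of `f` on `[0, T]`. -/
def basicNhd (f : SkorokhodSpace) (T : ℝ≥0) (ε : ℝ) : Set SkorokhodSpace :=
  {g | ∃ α : ℝ≥0 ≃o ℝ≥0, (∀ t, dist (α t) t < ε) ∧ ∀ t ≤ T, dist (g.1 (α t)) (f.1 t) < ε}

lemma basicNhd_mono (f : SkorokhodSpace) {T T' : ℝ≥0} {ε ε' : ℝ} (hT : T' ≤ T) (hε : ε ≤ ε') :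
    basicNhd f T ε ⊆ basicNhd f T' ε' := by
  rintro g ⟨α, h1, h2⟩
  exact ⟨α, fun t => (h1 t).trans_le hε, fun t ht => (h2 t (ht.trans hT)).trans_le hε⟩

/-- The Skorokhod `J₁` topology on `D[0, ∞)`: `fₙ → f` if and only if there are time changes `αₙ`
with `sup |αₙ t - t| → 0` and `fₙ ∘ αₙ → f` uniformly on every `[0, T]`. -/
instance : TopologicalSpace SkorokhodSpace where
  IsOpen U := ∀ f ∈ U, ∃ (T : ℝ≥0) (ε : ℝ), 0 < ε ∧ basicNhd f T ε ⊆ U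
  isOpen_univ := fun _ _ => ⟨0, 1, one_pos, Set.subset_univ _⟩
  isOpen_inter := by
    rintro U V hU hV f ⟨hfU, hfV⟩
    obtain ⟨T, ε, hε, h⟩ := hU f hfU
    obtain ⟨T', ε', hε', h'⟩ := hV f hfV
    exact ⟨max T T', min ε ε', lt_min hε hε', fun g hg =>
      ⟨h (basicNhd_mono f (le_max_left _ _) (min_le_left _ _) hg),
        h' (basicNhd_mono f (le_max_right _ _) (min_le_right _ _) hg)⟩⟩
  isOpen_sUnion := by
    rintro 𝒰 h𝒰 f ⟨U, hU, hf⟩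
    obtain ⟨T, ε, hε, h⟩ := h𝒰 U hU f hf
    exact ⟨T, ε, hε, h.trans (Set.subset_sUnion_of_mem hU)⟩

instance : MeasurableSpace SkorokhodSpace := borel SkorokhodSpace

instance : BorelSpace SkorokhodSpace := ⟨rfl⟩

/-- The path `t ↦ c t`. -/
noncomputable def linear (c : ℝ) : SkorokhodSpace :=
  ⟨fun t => c * t,
    { rightCont := fun t => by fun_prop
      leftLim := fun t =>
        ⟨c * t, (Continuous.tendsto (by fun_prop) t).mono_left nhdsWithin_le_nhds⟩ }⟩

end SkorokhodSpace

/-! ### Counting processes and Hawkes processes -/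

section Processes

variable {Ω : Type*} [MeasurableSpace Ω]

/-- A counting process: its paths start at `0` and are finite nondecreasing right-continuous step
functions with increments of size `+1`. -/
structure IsCountingProcess (N : ℝ≥0 → Ω → ℕ) : Prop where
  measurable : ∀ t, Measurable (N t)
  zero : ∀ ω, N 0 ω = 0
  mono : ∀ ω, Monotone fun t => N t ω
  rightCont : ∀ ω t, ContinuousWithinAt (fun s => N s ω) (Set.Ici t) t
  jump_le_one : ∀ ω t, ∀ᶠ s in 𝓝[<] t, N t ω ≤ N s ω + 1

/-- The history `𝓕ᴺ(t) = σ(N(s), s ≤ t)`. -/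
noncomputable def IsCountingProcess.history {N : ℝ≥0 → Ω → ℕ} (hN : IsCountingProcess N) :
    Filtration ℝ≥0 (inferInstance : MeasurableSpace Ω) :=
  Filtration.natural N fun t => (hN.measurable t).stronglyMeasurable

/-- The time of the `k`-th arrival (only used for `k ≤ N(t)` with some `t`, when it is finite). -/
noncomputable def arrivalTime (N : ℝ≥0 → Ω → ℕ) (k : ℕ) (ω : Ω) : ℝ≥0 :=
  sInf {t | k ≤ N t ω}

/-- The intensity `λ(t) = λ + ∫₀ᵗ μ(t - s) dN(s)`; the integral is the sum of `μ(t - Tₖ)` over the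
arrivals `T₁, …, T_{N(t)}` up to time `t`. -/
noncomputable def hawkesIntensity (lam : ℝ) (μ : ℝ → ℝ) (N : ℝ≥0 → Ω → ℕ) (t : ℝ≥0) (ω : Ω) : ℝ :=
  lam + ∑ k ∈ Finset.Icc 1 (N t ω), μ ((t : ℝ) - (arrivalTime N k ω : ℝ))

/-- The compensator `Λ(t) = ∫₀ᵗ λ(s) ds`. -/
noncomputable def hawkesCompensator (lam : ℝ) (μ : ℝ → ℝ) (N : ℝ≥0 → Ω → ℕ) (t : ℝ≥0) (ω : Ω) : ℝ :=
  ∫ s in (0 : ℝ)..(t : ℝ), hawkesIntensity lam μ N s.toNNReal ω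

/-- A one-dimensional Hawkes process with background intensity `lam` and response function `μ`: a
counting process with intensity `λ(t) = λ + ∫₀ᵗ μ(t - s) dN(s)` in its own history, that is,
`N(t) - ∫₀ᵗ λ(s) ds` is a local martingale in the natural filtration of `N`. -/
structure IsHawkesProcess (lam : ℝ) (μ : ℝ → ℝ) (N : ℝ≥0 → Ω → ℕ) (P : Measure Ω) : Prop where
  counting : IsCountingProcess N
  localMartingale :
    Locally (fun M : ℝ≥0 → Ω → ℝ => Martingale M counting.history P) counting.history
      (fun t ω => (N t ω : ℝ) - hawkesCompensator lam μ N t ω) P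

/-! ### Markov chains and the compound process -/

/-- A Markov chain `X₀, X₁, …` with states `Fin d`, transition matrix `Q` and arbitrary initial
distribution. -/
structure IsMarkovChain {d : ℕ} (Q : Matrix (Fin d) (Fin d) ℝ) (X : ℕ → Ω → Fin d)
    (P : Measure Ω) : Prop where
  measurable : ∀ k, Measurable (X k)
  stochastic : Q ∈ Matrix.rowStochastic ℝ (Fin d)
  markov : ∀ (k : ℕ) (x : ℕ → Fin d),
    P.real {ω | ∀ i ≤ k + 1, X i ω = x i} =
      P.real {ω | ∀ i ≤ k, X i ω = x i} * Q (x k) (x (k + 1))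

/-- The mid-price `S_t = S₀ + ∑_{k=1}^{N(t)} a(X_k)`. -/
noncomputable def midPrice {d : ℕ} (S₀ : Ω → ℝ) (a : Fin d → ℝ) (X : ℕ → Ω → Fin d)
    (N : ℝ≥0 → Ω → ℕ) (t : ℝ≥0) (ω : Ω) : ℝ :=
  S₀ ω + ∑ k ∈ Finset.Icc 1 (N t ω), a (X k ω)

lemma IsCountingProcess.isCadlag_comp {N : ℝ≥0 → Ω → ℕ} (hN : IsCountingProcess N) (ω : Ω)
    (c : ℝ≥0) (G : ℕ → ℝ) : IsCadlag fun t => G (N (c * t) ω) where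
  rightCont t := by
    have hG : Continuous G := continuous_of_discreteTopology
    have h : ContinuousWithinAt (fun s : ℝ≥0 => c * s) (Set.Ici t) t := by fun_prop
    have h2 : ContinuousWithinAt (fun s => N (c * s) ω) (Set.Ici t) t :=
      ContinuousWithinAt.comp (g := fun s => N s ω) (hN.rightCont ω (c * t)) h
        fun s hs => mul_le_mul_right hs c
    exact hG.continuousAt.comp_continuousWithinAt h2
  leftLim t := by
    have hG : Continuous G := continuous_of_discreteTopology
    have hm : Monotone fun t => N (c * t) ω := fun s s' hs =>
      hN.mono ω (mul_le_mul_right hs c)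
    exact ⟨_, (hG.tendsto _).comp (hm.tendsto_nhdsLT t)⟩

/-- The rescaled path `t ↦ S_{nt} / n`, as an element of `D[0, ∞)`. -/
noncomputable def rescaledMidPrice {d : ℕ} (S₀ : Ω → ℝ) (a : Fin d → ℝ) (X : ℕ → Ω → Fin d)
    {N : ℝ≥0 → Ω → ℕ} (hN : IsCountingProcess N) (n : ℕ) (ω : Ω) : SkorokhodSpace :=
  ⟨fun t => midPrice S₀ a X N (n * t) ω / n,
    hN.isCadlag_comp ω n fun m => (S₀ ω + ∑ k ∈ Finset.Icc 1 m, a (X k ω)) / n⟩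

end Processes

/-!
The limit path is deterministic and continuous, so convergence in distribution for the `J₁`
topology follows from locally uniform convergence in probability, with the identity as time change
(`tendstoInDistribution_linear`). Write `S_t = S₀ + B(N(t)) + â N(t)` with
`B(m) = ∑_{k ≤ m} (a(X_k) - â)`. It suffices that `B(m) / n → 0` uniformly for `m ≤ K n`, and that
`N(nt) / n → ρ t` uniformly for `t ≤ T`, where `ρ = λ / (1 - μ̂)`. As the first statement is uniform
in `m`, it can be evaluated at the random index `N(nt)`, whatever the joint law of `N` and `X`.

*The chain.* The Poisson equation `g - Q g = a - â` turns `B` into a martingale with bounded,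
orthogonal increments plus a bounded term, so that `E B(m)² = O(m)`. Uniformity in `m` comes from
boundedness of the increments and a finite grid (`tendsto_measureReal_exists_of_lipschitz`).

*The Hawkes process.* With `F(u) = ∫₀ᵘ μ`, the compensator is `λ t + ∑_{k ≤ N(t)} F(t - T_k)`
(`hawkesCompensator_eq`), hence lies between `λ t + F(u) N(t - u)` and `λ t + μ̂ N(t)`. Let
`M` be `N` minus its compensator.
* The upper bound reads `(1 - μ̂) N(t) ≤ M(t) + λ t`. Through Fatou's lemma along a localizing
  sequence it gives `E N(t) ≤ ρ t`, and then dominated convergence makes `M` a true martingale.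
* The lower bound, iterated in expectation, gives `E N(t) ≥ (ρ - ε) t - B`.
* `E |M(t)| = o(t)`: the quadratic variation of `M` is `N`. Since `M` is not known to be square
  integrable, this is used through the functions `√(R² + x²)`, whose second derivative is at most
  `1 / R`; summing second order expansions along finer and finer partitions yields
  `E |M(t)| ≤ R + (E N(t) + 1) / R` for every `R > 0`.

Since `N(t) - ρ t ≤ M(t) / (1 - μ̂)`, the positive part of `N(t) - ρ t` is `o(t)` in mean; since
also its mean is at least `- ε t - B`, the convergence `N(t) / t → ρ` holds in `L¹`. Monotonicity of
`N` makes it uniform on compact intervals (`tendsto_measureReal_exists_of_monotone`).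

Convergence in distribution also requires the rescaled paths to be Borel measurable for the `J₁`
topology. There are almost surely infinitely many arrivals, and then the path depends continuously
on the arrival times and on its values after each arrival (`eventually_rescaledMidPrice_mem`).
-/

/-! ### Paths of counting processes -/

lemma arrivalTime_le {Ω : Type*} {N : ℝ≥0 → Ω → ℕ} {k : ℕ} {t : ℝ≥0} {ω : Ω} (h : k ≤ N t ω) :
    arrivalTime N k ω ≤ t :=
  csInf_le (OrderBot.bddBelow _) h

lemma arrivalTime_zero {Ω : Type*} {N : ℝ≥0 → Ω → ℕ} (ω : Ω) : arrivalTime N 0 ω = 0 := by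
  simp [arrivalTime]

lemma hawkesCompensator_zero {Ω : Type*} {N : ℝ≥0 → Ω → ℕ} {μ : ℝ → ℝ} {lam : ℝ} (ω : Ω) :
    hawkesCompensator lam μ N 0 ω = 0 := by
  simp [hawkesCompensator]

namespace IsCountingProcess

variable {Ω : Type*} [MeasurableSpace Ω] {N : ℝ≥0 → Ω → ℕ}

lemma eventually_eq_right (hN : IsCountingProcess N) (ω : Ω) (t : ℝ≥0) :
    ∀ᶠ s in 𝓝[≥] t, N s ω = N t ω := by
  have h := hN.rightCont ω t
  rw [ContinuousWithinAt, nhds_discrete, tendsto_pure] at h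
  exact h

lemma le_apply_arrivalTime (hN : IsCountingProcess N) {k : ℕ} {t : ℝ≥0} {ω : Ω}
    (h : k ≤ N t ω) : k ≤ N (arrivalTime N k ω) ω := by
  by_contra! hlt
  have h1 := hN.eventually_eq_right ω (arrivalTime N k ω)
  obtain ⟨b, hb, hb'⟩ := (mem_nhdsGE_iff_exists_Ico_subset).1 h1
  have hne : {t | k ≤ N t ω}.Nonempty := ⟨t, h⟩
  obtain ⟨s, hs, hsb⟩ := (csInf_lt_iff (OrderBot.bddBelow _) hne).1 hb
  have := hb' ⟨arrivalTime_le hs, hsb⟩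
  simp only [Set.mem_ofPred_eq] at this hs
  omega

/-- For arrivals that do occur, `k ≤ N(s)` if and only if `T_k ≤ s`. -/
lemma arrivalTime_le_iff (hN : IsCountingProcess N) {k : ℕ} {t : ℝ≥0} {ω : Ω}
    (h : k ≤ N t ω) (s : ℝ≥0) : arrivalTime N k ω ≤ s ↔ k ≤ N s ω :=
  ⟨fun hs => (hN.le_apply_arrivalTime h).trans (hN.mono ω hs), arrivalTime_le⟩

lemma apply_arrivalTime (hN : IsCountingProcess N) {k : ℕ} {t : ℝ≥0} {ω : Ω}
    (h : k ≤ N t ω) : N (arrivalTime N k ω) ω = k := by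
  refine le_antisymm ?_ (hN.le_apply_arrivalTime h)
  rcases eq_or_ne (arrivalTime N k ω) 0 with h0 | h0
  · rw [h0, hN.zero]; exact Nat.zero_le _
  have : (𝓝[<] (arrivalTime N k ω)).NeBot := nhdsLT_neBot_of_exists_lt ⟨0, pos_iff_ne_zero.2 h0⟩
  obtain ⟨s, hs, hlt⟩ := ((hN.jump_le_one ω (arrivalTime N k ω)).and self_mem_nhdsWithin).exists
  have : N s ω < k := by
    by_contra! hk
    exact absurd (arrivalTime_le hk) (not_le.2 hlt)
  omega

lemma arrivalTime_lt_arrivalTime (hN : IsCountingProcess N) {j k : ℕ} {t : ℝ≥0} {ω : Ω}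
    (hjk : j < k) (h : k ≤ N t ω) : arrivalTime N j ω < arrivalTime N k ω := by
  by_contra! hle
  have := hN.mono ω hle
  simp only [hN.apply_arrivalTime h, hN.apply_arrivalTime (hjk.le.trans h)] at this
  omega

lemma measurable_arrivalTime (hN : IsCountingProcess N) (k : ℕ) :
    Measurable (arrivalTime N k) := by
  refine measurable_of_Iic fun t => ?_
  have : arrivalTime N k ⁻¹' Set.Iic t = {ω | k ≤ N t ω} ∪ ⋂ n : ℕ, {ω | N n ω < k} := by
    ext ω
    simp only [Set.mem_preimage, Set.mem_Iic, Set.mem_union, Set.mem_ofPred_eq, Set.mem_iInter]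
    by_cases hk : ∃ s, k ≤ N s ω
    · obtain ⟨s, hs⟩ := hk
      rw [hN.arrivalTime_le_iff hs]
      refine ⟨Or.inl, fun h => h.resolve_right fun h' => ?_⟩
      obtain ⟨n, hn⟩ := exists_nat_ge s
      exact absurd (hs.trans (hN.mono ω hn)) (not_le.2 (h' n))
    · have : {s | k ≤ N s ω} = ∅ := by
        ext s; simpa using not_exists.1 hk s
      have h0 : arrivalTime N k ω = 0 := by rw [arrivalTime, this]; simp
      push Not at hk
      simp [h0, hk]
  rw [this]
  exact (measurableSet_le measurable_const (hN.measurable t)).union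
    (MeasurableSet.iInter fun n => measurableSet_lt (hN.measurable n) measurable_const)

/-- Since jumps have size one, on a compact interval any two points that are close enough are
separated by at most one jump. -/
lemma exists_apply_le_add_one (hN : IsCountingProcess N) (ω : Ω) (t : ℝ≥0) :
    ∃ δ > 0, ∀ r s : ℝ≥0, r ≤ t → dist r s < δ → N s ω ≤ N r ω + 1 := by
  have key : ∀ r : ℝ≥0, ∃ U : Set ℝ≥0, IsOpen U ∧ r ∈ U ∧ ∀ s ∈ U, N s ω ≤ N r ω ∧
      N r ω ≤ N s ω + 1 := by
    intro r
    have h : ∀ᶠ s in 𝓝 r, N s ω ≤ N r ω ∧ N r ω ≤ N s ω + 1 := by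
      rw [← nhdsLT_sup_nhdsGE, eventually_sup]
      constructor
      · filter_upwards [hN.jump_le_one ω r, self_mem_nhdsWithin] with s hs hlt
        exact ⟨hN.mono ω (le_of_lt hlt), hs⟩
      · filter_upwards [hN.eventually_eq_right ω r] with s hs
        omega
    obtain ⟨U, hU, hUo, hr⟩ := eventually_nhds_iff.1 h
    exact ⟨U, hUo, hr, hU⟩
  choose U hUo hU hUN using key
  obtain ⟨δ, hδ, H⟩ := lebesgue_number_lemma_of_metric (c := U) (isCompact_Icc (a := 0) (b := t))
    hUo fun r _ => Set.mem_iUnion.2 ⟨r, hU r⟩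
  refine ⟨δ, hδ, fun r s hr hrs => ?_⟩
  obtain ⟨q, hq⟩ := H r ⟨zero_le, hr⟩
  have h1 := hUN q r (hq (Metric.mem_ball_self hδ))
  have h2 := hUN q s (hq (by rwa [Metric.mem_ball, dist_comm]))
  omega

end IsCountingProcess

/-! ### The compensator of a Hawkes process along a path -/

/-- The integrated response `∫₀ᵘ μ(s) ds`, equal to `0` for `u ≤ 0`. -/
noncomputable def integratedResponse (μ : ℝ → ℝ) (u : ℝ) : ℝ := ∫ s in Set.Ioc 0 u, μ s

section Response

variable {μ : ℝ → ℝ}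

lemma integratedResponse_of_nonpos {u : ℝ} (hu : u ≤ 0) : integratedResponse μ u = 0 := by
  simp [integratedResponse, Set.Ioc_eq_empty (not_lt.2 hu)]

lemma integratedResponse_mono (hμ : ∀ s, 0 ≤ s → 0 ≤ μ s) (hμi : IntegrableOn μ (Set.Ioi 0)) :
    Monotone (integratedResponse μ) := fun _ _ huv =>
  setIntegral_mono_set (hμi.mono_set Set.Ioc_subset_Ioi_self)
    ((ae_restrict_mem measurableSet_Ioc).mono fun s hs => hμ s hs.1.le)
    (Set.Ioc_subset_Ioc_right huv).eventuallyLE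

lemma integratedResponse_nonneg (hμ : ∀ s, 0 ≤ s → 0 ≤ μ s) (u : ℝ) :
    0 ≤ integratedResponse μ u :=
  setIntegral_nonneg measurableSet_Ioc fun s hs => hμ s hs.1.le

lemma integratedResponse_le (hμ : ∀ s, 0 ≤ s → 0 ≤ μ s) (hμi : IntegrableOn μ (Set.Ioi 0))
    (u : ℝ) : integratedResponse μ u ≤ ∫ s in Set.Ioi 0, μ s :=
  setIntegral_mono_set hμi ((ae_restrict_mem measurableSet_Ioi).mono fun s hs => hμ s (le_of_lt hs))
    Set.Ioc_subset_Ioi_self.eventuallyLE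

lemma integratedResponse_eq_primitive (μ : ℝ → ℝ) :
    integratedResponse μ = fun u => ∫ s in (0 : ℝ)..u, (Set.Ioi 0).indicator μ s := by
  ext u
  rcases le_total 0 u with hu | hu
  · rw [intervalIntegral.integral_of_le hu, integratedResponse]
    exact setIntegral_congr_fun measurableSet_Ioc fun s hs => by simp [hs.1]
  · rw [integratedResponse_of_nonpos hu, intervalIntegral.integral_of_ge hu]
    rw [setIntegral_eq_zero_of_forall_eq_zero, neg_zero]
    intro s hs
    simp [not_lt.2 hs.2]

lemma continuous_integratedResponse (hμi : IntegrableOn μ (Set.Ioi 0)) :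
    Continuous (integratedResponse μ) := by
  rw [integratedResponse_eq_primitive]
  exact intervalIntegral.continuous_primitive
    (fun a b => ((integrable_indicator_iff measurableSet_Ioi).2 hμi).intervalIntegrable) 0

lemma tendsto_integratedResponse (hμi : IntegrableOn μ (Set.Ioi 0)) :
    Tendsto (integratedResponse μ) atTop (𝓝 (∫ s in Set.Ioi 0, μ s)) := by
  refine (intervalIntegral_tendsto_integral_Ioi 0 hμi tendsto_id).congr' ?_
  filter_upwards [eventually_ge_atTop 0] with u hu
  rw [id, intervalIntegral.integral_of_le hu, integratedResponse]

end Response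

section Compensator

variable {Ω : Type*} [MeasurableSpace Ω] {N : ℝ≥0 → Ω → ℕ} {μ : ℝ → ℝ} {lam : ℝ}

/-- The part of the integrated response that an arrival at time `r` contributes up to time `t`. -/
lemma integral_shifted_response (hμi : IntegrableOn μ (Set.Ioi 0)) (r t : ℝ)
    (hr : 0 ≤ r) :
    IntervalIntegrable (fun s => (Set.Ioi r).indicator (fun s => μ (s - r)) s) volume 0 t ∧
    ∫ s in (0 : ℝ)..t, (Set.Ioi r).indicator (fun s => μ (s - r)) s
      = integratedResponse μ (t - r) := by
  have heq : (fun s => (Set.Ioi r).indicator (fun s => μ (s - r)) s)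
      = fun s => (Set.Ioi 0).indicator μ (s - r) := by
    ext s
    simp [Set.indicator_apply, sub_pos]
  have hi : Integrable ((Set.Ioi 0).indicator μ) :=
    (integrable_indicator_iff measurableSet_Ioi).2 hμi
  rw [heq]
  refine ⟨(hi.comp_sub_right r).intervalIntegrable, ?_⟩
  rw [intervalIntegral.integral_comp_sub_right (f := (Set.Ioi 0).indicator μ),
    integratedResponse_eq_primitive, zero_sub,
    ← intervalIntegral.integral_add_adjacent_intervals (b := 0) hi.intervalIntegrable
      hi.intervalIntegrable, intervalIntegral.integral_of_le (neg_nonpos.2 hr)]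
  rw [setIntegral_eq_zero_of_forall_eq_zero, zero_add]
  intro s hs
  simp [not_lt.2 hs.2]

/-- The compensator is `λ t + ∑_{k ≤ N(t')} F(t - T_k)` with `F` the integrated response. Any
`t' ≥ t` may be used, since arrivals after `t` contribute nothing; with a fixed `t'` the sum has a
fixed number of terms, from which continuity in `t` is read off. -/
lemma hawkesCompensator_eq (hN : IsCountingProcess N) (hμi : IntegrableOn μ (Set.Ioi 0))
    (ω : Ω) {t t' : ℝ≥0} (htt : t ≤ t') :
    hawkesCompensator lam μ N t ω = lam * t +
      ∑ k ∈ Finset.Icc 1 (N t' ω), integratedResponse μ ((t : ℝ) - (arrivalTime N k ω : ℝ)) := by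
  have hsub : Finset.Icc 1 (N t ω) ⊆ Finset.Icc 1 (N t' ω) :=
    Finset.Icc_subset_Icc_right (hN.mono ω htt)
  rw [← Finset.sum_subset hsub]
  swap
  · intro k hk hk'
    apply integratedResponse_of_nonpos
    simp only [Finset.mem_Icc, not_and, not_le] at hk hk'
    have : ¬ arrivalTime N k ω ≤ t := by
      rw [hN.arrivalTime_le_iff hk.2]
      exact not_le.2 (hk' hk.1)
    have h2 : (t : ℝ) < arrivalTime N k ω := by exact_mod_cast not_le.1 this
    linarith
  have hI := fun k => integral_shifted_response hμi (arrivalTime N k ω) t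
    (arrivalTime N k ω).2
  rw [hawkesCompensator]
  -- The intensity agrees with a fixed finite sum off the countable set of arrival times.
  have hae : ∀ᵐ s : ℝ, s ∈ Set.uIoc 0 (t : ℝ) → hawkesIntensity lam μ N s.toNNReal ω =
      lam + ∑ k ∈ Finset.Icc 1 (N t ω), (Set.Ioi (arrivalTime N k ω : ℝ)).indicator
        (fun s => μ (s - arrivalTime N k ω)) s := by
    have hcount : (Set.range fun k => (arrivalTime N k ω : ℝ)).Countable := Set.countable_range _
    filter_upwards [hcount.ae_notMem volume] with s hs hst
    rw [Set.uIoc_of_le t.coe_nonneg] at hst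
    have hs0 : ((s.toNNReal : ℝ≥0) : ℝ) = s := Real.coe_toNNReal s hst.1.le
    have hle : s.toNNReal ≤ t := by
      rw [← NNReal.coe_le_coe, hs0]; exact hst.2
    rw [hawkesIntensity, hs0]
    congr 1
    rw [← Finset.sum_subset (Finset.Icc_subset_Icc_right (hN.mono ω hle))]
    · refine Finset.sum_congr rfl fun k hk => ?_
      have h1 : (arrivalTime N k ω : ℝ) ≤ s := by
        rw [← hs0, NNReal.coe_le_coe]
        exact arrivalTime_le (Finset.mem_Icc.1 hk).2
      have h2 : (arrivalTime N k ω : ℝ) < s := lt_of_le_of_ne h1 fun h => hs ⟨k, h⟩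
      simp [h2]
    · intro k hk hk'
      simp only [Finset.mem_Icc, not_and, not_le] at hk hk'
      have : ¬ arrivalTime N k ω ≤ s.toNNReal := by
        rw [hN.arrivalTime_le_iff hk.2]
        exact not_le.2 (hk' hk.1)
      have h2 : s < arrivalTime N k ω := by rw [← hs0]; exact_mod_cast not_le.1 this
      simp [h2.le]
  rw [intervalIntegral.integral_congr_ae hae, intervalIntegral.integral_add
    intervalIntegrable_const, intervalIntegral.integral_finsetSum fun k hk => (hI k).1,
    Finset.sum_congr rfl fun k hk => (hI k).2]
  · simp [mul_comm]
  · have := IntervalIntegrable.sum (μ := volume) (a := 0) (b := (t : ℝ)) (Finset.Icc 1 (N t ω))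
      fun k hk => (hI k).1
    refine this.congr fun s _ => ?_
    simp

lemma continuous_hawkesCompensator (hN : IsCountingProcess N) (hμi : IntegrableOn μ (Set.Ioi 0))
    (ω : Ω) : Continuous fun t => hawkesCompensator lam μ N t ω := by
  rw [continuous_iff_continuousAt]
  intro t
  have hev : ∀ᶠ s in 𝓝 t, s ≤ t + 1 := eventually_le_nhds (lt_add_one t)
  refine ContinuousAt.congr ?_ (hev.mono fun s hs => (hawkesCompensator_eq hN hμi ω hs).symm)
  have := continuous_integratedResponse hμi
  fun_prop

lemma hawkesCompensator_mono (hN : IsCountingProcess N) (hlam : 0 ≤ lam)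
    (hμ : ∀ s, 0 ≤ s → 0 ≤ μ s) (hμi : IntegrableOn μ (Set.Ioi 0)) (ω : Ω) :
    Monotone fun t => hawkesCompensator lam μ N t ω := by
  intro s t hst
  simp only
  rw [hawkesCompensator_eq hN hμi ω hst, hawkesCompensator_eq hN hμi ω le_rfl]
  have hst' : (s : ℝ) ≤ t := hst
  gcongr
  exact integratedResponse_mono hμ hμi (by linarith)

lemma hawkesCompensator_le (hN : IsCountingProcess N)
    (hμ : ∀ s, 0 ≤ s → 0 ≤ μ s) (hμi : IntegrableOn μ (Set.Ioi 0)) (t : ℝ≥0) (ω : Ω) :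
    hawkesCompensator lam μ N t ω ≤ lam * t + (∫ s in Set.Ioi 0, μ s) * N t ω := by
  rw [hawkesCompensator_eq hN hμi ω le_rfl]
  gcongr
  refine (Finset.sum_le_card_nsmul _ _ _ fun k _ => integratedResponse_le hμ hμi _).trans ?_
  simp [mul_comm]

/-- At time `t + u` each of the `N(t)` arrivals up to `t` has contributed at least `F(u)`. -/
lemma le_hawkesCompensator (hN : IsCountingProcess N)
    (hμ : ∀ s, 0 ≤ s → 0 ≤ μ s) (hμi : IntegrableOn μ (Set.Ioi 0)) (t u : ℝ≥0) (ω : Ω) :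
    lam * (t + u : ℝ≥0) + integratedResponse μ u * N t ω ≤ hawkesCompensator lam μ N (t + u) ω := by
  rw [hawkesCompensator_eq hN hμi ω le_rfl]
  gcongr
  calc integratedResponse μ u * N t ω = ∑ k ∈ Finset.Icc 1 (N t ω), integratedResponse μ u := by
        simp [mul_comm]
    _ ≤ ∑ k ∈ Finset.Icc 1 (N t ω),
        integratedResponse μ (((t + u : ℝ≥0) : ℝ) - (arrivalTime N k ω : ℝ)) := by
        refine Finset.sum_le_sum fun k hk => integratedResponse_mono hμ hμi ?_
        have : (arrivalTime N k ω : ℝ) ≤ t :=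
          NNReal.coe_le_coe.2 (arrivalTime_le (Finset.mem_Icc.1 hk).2)
        push_cast
        linarith
    _ ≤ _ := Finset.sum_le_sum_of_subset_of_nonneg
        (Finset.Icc_subset_Icc_right (hN.mono ω le_self_add))
        fun k _ _ => integratedResponse_nonneg hμ _

lemma measurable_hawkesCompensator (hN : IsCountingProcess N) (hμi : IntegrableOn μ (Set.Ioi 0))
    (t : ℝ≥0) : Measurable (hawkesCompensator lam μ N t) := by
  have h : hawkesCompensator lam μ N t = fun ω => lam * t + ∑ k ∈ Finset.Icc 1 (N t ω),
      integratedResponse μ ((t : ℝ) - (arrivalTime N k ω : ℝ)) :=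
    funext fun ω => hawkesCompensator_eq hN hμi ω le_rfl
  rw [h]
  have hF := (continuous_integratedResponse hμi).measurable
  have hT := hN.measurable_arrivalTime
  have hG : Measurable fun p : Ω × ℕ => ∑ k ∈ Finset.Icc 1 p.2,
      integratedResponse μ ((t : ℝ) - (arrivalTime N k p.1 : ℝ)) := by
    refine measurable_from_prod_countable_left fun n => ?_
    exact Finset.measurable_fun_sum (Finset.Icc 1 n) fun k _ =>
      hF.comp ((hT k).coe_nnreal_real.const_sub _)
  have hc := hG.comp (measurable_id.prodMk (hN.measurable t))
  exact hc.const_add (lam * t)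

end Compensator

/-! ### The compensated Hawkes process -/

/-- The compensated process `M(t) = N(t) - ∫₀ᵗ λ(s) ds`. -/
noncomputable def compensatedHawkes {Ω : Type*} (lam : ℝ) (μ : ℝ → ℝ) (N : ℝ≥0 → Ω → ℕ)
    (t : ℝ≥0) (ω : Ω) : ℝ :=
  N t ω - hawkesCompensator lam μ N t ω

section Martingale

variable {Ω : Type*} [MeasurableSpace Ω] {P : Measure Ω} {N : ℝ≥0 → Ω → ℕ}
  {μ : ℝ → ℝ} {lam : ℝ}

/-- The local martingale property, with the stopped times `σ n t = t ∧ τ n` made explicit. The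
indicator in the definition of a localizing sequence plays no role because `M(0) = 0`. -/
lemma IsHawkesProcess.exists_localization (hH : IsHawkesProcess lam μ N P) :
    ∃ σ : ℕ → ℝ≥0 → Ω → ℝ≥0, (∀ n t ω, σ n t ω ≤ t) ∧
      (∀ᵐ ω ∂P, ∀ t, ∀ᶠ n in atTop, σ n t ω = t) ∧
      ∀ n, Martingale (fun t ω => compensatedHawkes lam μ N (σ n t ω) ω)
        hH.counting.history P := by
  obtain ⟨τ, hτ, hM⟩ := hH.localMartingale
  refine ⟨fun n t ω => (min (t : WithTop ℝ≥0) (τ n ω)).untopA, fun n t ω => ?_, ?_, fun n => ?_⟩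
  · exact (WithTop.untopA_le_iff ((min_le_left _ _).trans_lt (WithTop.coe_lt_top t)).ne).2
      (min_le_left _ _)
  · filter_upwards [hτ.tendsto_top] with ω hω t
    filter_upwards [hω.eventually (eventually_gt_nhds (WithTop.coe_lt_top t))] with n hn
    rw [min_eq_left hn.le]
    rfl
  · convert hM n using 1
    ext t ω
    simp only [stoppedProcess, Set.indicator_apply, Set.mem_ofPred_eq, compensatedHawkes]
    split_ifs with h
    · rfl
    · have h0 : τ n ω = ⊥ := by simpa using h
      have : (min (t : WithTop ℝ≥0) (τ n ω)).untopA = 0 := by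
        rw [h0, min_eq_right bot_le]; rfl
      rw [this, hH.counting.zero, hawkesCompensator_zero]
      simp

lemma le_compensatedHawkes (hN : IsCountingProcess N)
    (hμ : ∀ s, 0 ≤ s → 0 ≤ μ s) (hμi : IntegrableOn μ (Set.Ioi 0)) (t : ℝ≥0) (ω : Ω) :
    (1 - ∫ s in Set.Ioi 0, μ s) * N t ω ≤ compensatedHawkes lam μ N t ω + lam * t := by
  have := hawkesCompensator_le (lam := lam) hN hμ hμi t ω
  rw [compensatedHawkes]
  linarith

variable [IsProbabilityMeasure P]

/-- The pathwise bound `(1 - μ̂) N(t) ≤ M(t) + λ t` and Fatou's lemma along a localizing sequence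
bound the mean of `N(t)`. -/
lemma IsHawkesProcess.integrable_and_integral_le (hH : IsHawkesProcess lam μ N P)
    (hlam : 0 ≤ lam) (hμ : ∀ s, 0 ≤ s → 0 ≤ μ s) (hμi : IntegrableOn μ (Set.Ioi 0))
    (hμ1 : ∫ s in Set.Ioi (0 : ℝ), μ s < 1) (t : ℝ≥0) :
    Integrable (fun ω => (N t ω : ℝ)) P ∧
      ∫ ω, (N t ω : ℝ) ∂P ≤ lam / (1 - ∫ s in Set.Ioi (0 : ℝ), μ s) * t := by
  obtain ⟨σ, hσ, hσt, hM⟩ := hH.exists_localization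
  have hN := hH.counting
  have hp : 0 < 1 - ∫ s in Set.Ioi (0 : ℝ), μ s := by linarith
  have hmeas : Measurable fun ω => (N t ω : ℝ) := measurable_from_top.comp (hN.measurable t)
  have hnn : ∀ (s : ℝ≥0) ω, 0 ≤ compensatedHawkes lam μ N s ω + lam * s := fun s ω =>
    le_trans (by positivity) (le_compensatedHawkes hN hμ hμi s ω)
  have hmean : ∀ n, ∫ ω, compensatedHawkes lam μ N (σ n t ω) ω ∂P = 0 := by
    intro n
    have h := (hM n).setIntegral_eq (zero_le (a := t)) (s := Set.univ) MeasurableSet.univ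
    simp only [Measure.restrict_univ] at h
    rw [← h]
    refine integral_eq_zero_of_ae (ae_of_all _ fun ω => ?_)
    have : σ n 0 ω = 0 := le_antisymm (hσ n 0 ω) zero_le
    simp [this, compensatedHawkes, hN.zero, hawkesCompensator_zero]
  have hnnσ : ∀ n ω, 0 ≤ compensatedHawkes lam μ N (σ n t ω) ω + lam * t := by
    intro n ω
    have h1 := hnn (σ n t ω) ω
    have h2 : (σ n t ω : ℝ) ≤ t := hσ n t ω
    nlinarith
  have hint : ∀ n, ∫⁻ ω, ENNReal.ofReal (compensatedHawkes lam μ N (σ n t ω) ω + lam * t) ∂P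
      = ENNReal.ofReal (lam * t) := by
    intro n
    have hi : Integrable (fun ω => compensatedHawkes lam μ N (σ n t ω) ω + lam * t) P :=
      ((hM n).integrable t).add (integrable_const _)
    rw [← ofReal_integral_eq_lintegral_ofReal hi (ae_of_all _ (hnnσ n)),
      integral_add ((hM n).integrable t) (integrable_const _), hmean]
    simp
  have hfatou : ∫⁻ ω, ENNReal.ofReal ((1 - ∫ s in Set.Ioi (0 : ℝ), μ s) * N t ω) ∂P
      ≤ ENNReal.ofReal (lam * t) := by
    calc _ ≤ ∫⁻ ω, liminf (fun n => ENNReal.ofReal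
          (compensatedHawkes lam μ N (σ n t ω) ω + lam * t)) atTop ∂P := by
          refine lintegral_mono_ae (hσt.mono fun ω hω => ?_)
          have : Tendsto (fun n => ENNReal.ofReal
              (compensatedHawkes lam μ N (σ n t ω) ω + lam * t)) atTop
              (𝓝 (ENNReal.ofReal (compensatedHawkes lam μ N t ω + lam * t))) :=
            tendsto_const_nhds.congr' ((hω t).mono fun n hn => by simp only [hn])
          rw [this.liminf_eq]
          exact ENNReal.ofReal_le_ofReal (le_compensatedHawkes hN hμ hμi t ω)
      _ ≤ liminf (fun n => ∫⁻ ω, ENNReal.ofReal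
          (compensatedHawkes lam μ N (σ n t ω) ω + lam * t) ∂P) atTop :=
          lintegral_liminf_le' fun n =>
            ((hM n).integrable t).aestronglyMeasurable.aemeasurable.add_const _ |>.ennreal_ofReal
      _ = ENNReal.ofReal (lam * t) := by simp [hint]
  have hI : Integrable (fun ω => (1 - ∫ s in Set.Ioi (0 : ℝ), μ s) * (N t ω : ℝ)) P := by
    rw [← lintegral_ofReal_ne_top_iff_integrable (hmeas.const_mul _).aestronglyMeasurable
      (ae_of_all _ fun ω => by positivity)]
    exact ne_top_of_le_ne_top ENNReal.ofReal_ne_top hfatou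
  refine ⟨?_, ?_⟩
  · convert hI.const_mul (1 - ∫ s in Set.Ioi (0 : ℝ), μ s)⁻¹ using 2 with ω
    field_simp
  · rw [div_mul_eq_mul_div, le_div_iff₀ hp, mul_comm, ← integral_const_mul]
    rw [← ofReal_integral_eq_lintegral_ofReal hI (ae_of_all _ fun ω => by positivity)] at hfatou
    exact (ENNReal.ofReal_le_ofReal_iff (by positivity)).1 hfatou

lemma abs_compensatedHawkes_le (hN : IsCountingProcess N) (hlam : 0 ≤ lam)
    (hμ : ∀ s, 0 ≤ s → 0 ≤ μ s) (hμi : IntegrableOn μ (Set.Ioi 0)) {s t : ℝ≥0} (hst : s ≤ t)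
    (ω : Ω) : |compensatedHawkes lam μ N s ω| ≤ N t ω + hawkesCompensator lam μ N t ω := by
  have h1 := hawkesCompensator_mono hN hlam hμ hμi ω hst
  have h2 := hawkesCompensator_mono hN hlam hμ hμi ω (zero_le (a := s))
  simp only [hawkesCompensator_zero] at h1 h2
  have h3 : (N s ω : ℝ) ≤ N t ω := by exact_mod_cast hN.mono ω hst
  have h4 : (0 : ℝ) ≤ N s ω := by positivity
  rw [compensatedHawkes, abs_le]
  constructor <;> linarith

lemma IsHawkesProcess.integrable_hawkesCompensator (hH : IsHawkesProcess lam μ N P)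
    (hlam : 0 ≤ lam) (hμ : ∀ s, 0 ≤ s → 0 ≤ μ s) (hμi : IntegrableOn μ (Set.Ioi 0))
    (hμ1 : ∫ s in Set.Ioi (0 : ℝ), μ s < 1) (t : ℝ≥0) :
    Integrable (hawkesCompensator lam μ N t) P := by
  have hN := hH.counting
  have hi := (hH.integrable_and_integral_le hlam hμ hμi hμ1 t).1
  refine ((integrable_const (lam * t)).add (hi.const_mul (∫ s in Set.Ioi (0 : ℝ), μ s))).mono'
    (measurable_hawkesCompensator hN hμi t).aestronglyMeasurable (ae_of_all _ fun ω => ?_)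
  have h2 := hawkesCompensator_mono hN hlam hμ hμi ω (zero_le (a := t))
  simp only [hawkesCompensator_zero] at h2
  rw [Real.norm_of_nonneg h2]
  exact hawkesCompensator_le hN hμ hμi t ω

lemma IsHawkesProcess.integrable_compensatedHawkes (hH : IsHawkesProcess lam μ N P)
    (hlam : 0 ≤ lam) (hμ : ∀ s, 0 ≤ s → 0 ≤ μ s) (hμi : IntegrableOn μ (Set.Ioi 0))
    (hμ1 : ∫ s in Set.Ioi (0 : ℝ), μ s < 1) (t : ℝ≥0) :
    Integrable (compensatedHawkes lam μ N t) P :=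
  (hH.integrable_and_integral_le hlam hμ hμi hμ1 t).1.sub
    (hH.integrable_hawkesCompensator hlam hμ hμi hμ1 t)

/-- Bounded continuous functions of `M(s)` are orthogonal to the increment `M(t) - M(s)`: this is
what is used of the fact that `M` is a true martingale. -/
lemma IsHawkesProcess.integral_mul_increment_eq_zero (hH : IsHawkesProcess lam μ N P)
    (hlam : 0 ≤ lam) (hμ : ∀ s, 0 ≤ s → 0 ≤ μ s) (hμi : IntegrableOn μ (Set.Ioi 0))
    (hμ1 : ∫ s in Set.Ioi (0 : ℝ), μ s < 1) {s t : ℝ≥0} (hst : s ≤ t) {ψ : ℝ → ℝ}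
    (hψ : Continuous ψ) {c : ℝ} (hψc : ∀ x, |ψ x| ≤ c) :
    ∫ ω, ψ (compensatedHawkes lam μ N s ω) *
      (compensatedHawkes lam μ N t ω - compensatedHawkes lam μ N s ω) ∂P = 0 := by
  obtain ⟨σ, hσ, hσt, hM⟩ := hH.exists_localization
  have hN := hH.counting
  set Y : ℕ → ℝ≥0 → Ω → ℝ := fun n t ω => compensatedHawkes lam μ N (σ n t ω) ω with hY
  have hzero : ∀ n, ∫ ω, ψ (Y n s ω) * (Y n t ω - Y n s ω) ∂P = 0 := by
    intro n
    have hle := hH.counting.history.le s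
    have hsm : StronglyMeasurable[hH.counting.history s] fun ω => ψ (Y n s ω) :=
      hψ.comp_stronglyMeasurable ((hM n).1 s)
    have hD : Integrable (Y n t - Y n s) P := ((hM n).integrable t).sub ((hM n).integrable s)
    have hpull := condExp_stronglyMeasurable_mul_of_bound hle hsm hD c
      (ae_of_all _ fun ω => hψc _)
    have hcond : P[Y n t - Y n s | hH.counting.history s] =ᵐ[P] 0 := by
      filter_upwards [condExp_sub ((hM n).integrable t) ((hM n).integrable s)
        (hH.counting.history s), (hM n).2 s t hst, (hM n).2 s s le_rfl] with ω h1 h2 h3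
      rw [h1, Pi.sub_apply, h2, h3]
      simp
    calc _ = ∫ ω, ((fun ω => ψ (Y n s ω)) * (Y n t - Y n s)) ω ∂P := rfl
      _ = ∫ ω, (P[(fun ω => ψ (Y n s ω)) * (Y n t - Y n s) | hH.counting.history s]) ω ∂P :=
          (integral_condExp hle).symm
      _ = 0 := by
          refine integral_eq_zero_of_ae ?_
          filter_upwards [hpull, hcond] with ω h1 h2
          rw [h1, Pi.mul_apply, h2]
          simp
  have hlim := tendsto_integral_of_dominated_convergence (μ := P)
    (F := fun n ω => ψ (Y n s ω) * (Y n t ω - Y n s ω))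
    (f := fun ω => ψ (compensatedHawkes lam μ N s ω) *
      (compensatedHawkes lam μ N t ω - compensatedHawkes lam μ N s ω))
    (fun ω => c * (2 * (N t ω + hawkesCompensator lam μ N t ω)))
    (fun n => (hψ.comp_aestronglyMeasurable ((hM n).integrable s).aestronglyMeasurable).mul
      (((hM n).integrable t).sub ((hM n).integrable s)).aestronglyMeasurable)
    ((((hH.integrable_and_integral_le hlam hμ hμi hμ1 t).1.add
      (hH.integrable_hawkesCompensator hlam hμ hμi hμ1 t)).const_mul 2).const_mul c)
    (fun n => ae_of_all _ fun ω => by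
      have h1 := abs_compensatedHawkes_le hN hlam hμ hμi (hσ n t ω) ω
      have h2 := abs_compensatedHawkes_le hN hlam hμ hμi ((hσ n s ω).trans hst) ω
      rw [norm_mul, Real.norm_eq_abs, Real.norm_eq_abs]
      refine mul_le_mul (hψc _) ?_ (abs_nonneg _) ((abs_nonneg _).trans (hψc 0))
      refine (abs_sub _ _).trans ?_
      linarith)
    (hσt.mono fun ω hω => tendsto_const_nhds.congr' (by
      filter_upwards [hω s, hω t] with n h1 h2
      simp only [hY, h1, h2]))
  simp only [hzero] at hlim
  exact tendsto_nhds_unique hlim tendsto_const_nhds |>.symm ▸ rfl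

/-- `M` is centred, that is, `N(t)` and its compensator have the same mean. -/
lemma IsHawkesProcess.integral_eq_integral_hawkesCompensator (hH : IsHawkesProcess lam μ N P)
    (hlam : 0 ≤ lam) (hμ : ∀ s, 0 ≤ s → 0 ≤ μ s) (hμi : IntegrableOn μ (Set.Ioi 0))
    (hμ1 : ∫ s in Set.Ioi (0 : ℝ), μ s < 1) (t : ℝ≥0) :
    ∫ ω, (N t ω : ℝ) ∂P = ∫ ω, hawkesCompensator lam μ N t ω ∂P := by
  have h := hH.integral_mul_increment_eq_zero hlam hμ hμi hμ1 (zero_le (a := t))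
    (continuous_const (y := (1 : ℝ))) (c := 1) (by simp)
  have h0 : ∀ ω, compensatedHawkes lam μ N 0 ω = 0 := fun ω => by
    simp [compensatedHawkes, hH.counting.zero, hawkesCompensator_zero]
  simp only [h0, one_mul, sub_zero] at h
  simp only [compensatedHawkes] at h
  rw [integral_sub (hH.integrable_and_integral_le hlam hμ hμi hμ1 t).1
    (hH.integrable_hawkesCompensator hlam hμ hμi hμ1 t)] at h
  linarith

end Martingale

/-! ### A first moment bound for the compensated process -/

/-- Second order expansion of `x ↦ √(R² + x²)`, a smooth substitute for `|x|` whose second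
derivative is at most `1 / R`. -/
lemma sqrt_sq_add_sq_le {R : ℝ} (hR : 0 < R) (x y : ℝ) :
    √(R ^ 2 + y ^ 2) ≤ √(R ^ 2 + x ^ 2) + x / √(R ^ 2 + x ^ 2) * (y - x) +
      min ((y - x) ^ 2 / (2 * R)) (2 * |y - x|) := by
  have hx : 0 < R ^ 2 + x ^ 2 := by positivity
  have hVx := Real.sqrt_pos.2 hx
  have hx2 := Real.sq_sqrt hx.le
  have hy2 := Real.sq_sqrt (show 0 ≤ R ^ 2 + y ^ 2 by positivity)
  have hRx : R ≤ √(R ^ 2 + x ^ 2) := Real.le_sqrt_of_sq_le (by nlinarith [sq_nonneg x])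
  have hxx : |x| ≤ √(R ^ 2 + x ^ 2) := Real.abs_le_sqrt (by nlinarith)
  set v := √(R ^ 2 + x ^ 2)
  set w := √(R ^ 2 + y ^ 2)
  rw [← min_add_add_left, le_min_iff]
  constructor
  · have h1 : w ≤ v + x / v * (y - x) + (y - x) ^ 2 / (2 * v) := by
      have : v + x / v * (y - x) + (y - x) ^ 2 / (2 * v)
          = (2 * v ^ 2 + 2 * x * (y - x) + (y - x) ^ 2) / (2 * v) := by field_simp
      rw [this, le_div_iff₀ (by positivity)]
      nlinarith [sq_nonneg (w - v)]
    have h2 : (y - x) ^ 2 / (2 * v) ≤ (y - x) ^ 2 / (2 * R) := by gcongr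
    linarith
  · have h1 : w ≤ v + |y - x| := by
      refine Real.sqrt_le_iff.2 ⟨by positivity, ?_⟩
      have h3 : x * (y - x) ≤ v * |y - x| :=
        (le_abs_self _).trans (by rw [abs_mul]; gcongr)
      nlinarith [sq_abs (y - x)]
    have h2 : -(x / v * (y - x)) ≤ |y - x| := by
      refine (neg_le_abs _).trans ?_
      rw [abs_mul, abs_div, abs_of_pos hVx]
      exact mul_le_of_le_one_left (abs_nonneg _) ((div_le_one hVx).2 hxx)
    linarith

section MomentBound

variable {Ω : Type*} [MeasurableSpace Ω] {P : Measure Ω}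
  {N : ℝ≥0 → Ω → ℕ} {μ : ℝ → ℝ} {lam : ℝ}

lemma integrable_sqrt_sq_add_sq [IsFiniteMeasure P] {f : Ω → ℝ} (hf : Integrable f P) (R : ℝ) :
    Integrable (fun ω => √(R ^ 2 + f ω ^ 2)) P := by
  refine ((integrable_const |R|).add hf.norm).mono' ?_ (ae_of_all _ fun ω => ?_)
  · exact (Continuous.comp_aestronglyMeasurable (g := fun x => √(R ^ 2 + x ^ 2)) (by fun_prop)
      hf.aestronglyMeasurable)
  · rw [Real.norm_of_nonneg (Real.sqrt_nonneg _), Pi.add_apply, Real.norm_eq_abs]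
    refine Real.sqrt_le_iff.2 ⟨by positivity, ?_⟩
    nlinarith [sq_abs R, sq_abs (f ω), mul_nonneg (abs_nonneg R) (abs_nonneg (f ω))]

lemma integrable_min_sq_abs {f : Ω → ℝ} (hf : Integrable f P) {R : ℝ} (hR : 0 < R) :
    Integrable (fun ω => min (f ω ^ 2 / (2 * R)) (2 * |f ω|)) P := by
  refine (hf.norm.const_mul 2).mono' ?_ (ae_of_all _ fun ω => ?_)
  · exact (Continuous.comp_aestronglyMeasurable
      (g := fun x => min (x ^ 2 / (2 * R)) (2 * |x|)) (by fun_prop) hf.aestronglyMeasurable)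
  · rw [Real.norm_of_nonneg (by positivity)]
    exact min_le_right _ _

variable [IsProbabilityMeasure P]

/-- Summing the second order expansion along a partition: the first order terms have mean zero. -/
lemma IsHawkesProcess.integral_sqrt_le_partition (hH : IsHawkesProcess lam μ N P)
    (hlam : 0 ≤ lam) (hμ : ∀ s, 0 ≤ s → 0 ≤ μ s) (hμi : IntegrableOn μ (Set.Ioi 0))
    (hμ1 : ∫ s in Set.Ioi (0 : ℝ), μ s < 1) {R : ℝ} (hR : 0 < R) {u : ℕ → ℝ≥0}
    (hu : Monotone u) (hu0 : u 0 = 0) (K : ℕ) :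
    ∫ ω, √(R ^ 2 + compensatedHawkes lam μ N (u K) ω ^ 2) ∂P ≤ R +
      ∫ ω, ∑ i ∈ Finset.range K, min ((compensatedHawkes lam μ N (u (i + 1)) ω -
        compensatedHawkes lam μ N (u i) ω) ^ 2 / (2 * R))
        (2 * |compensatedHawkes lam μ N (u (i + 1)) ω - compensatedHawkes lam μ N (u i) ω|) ∂P := by
  have hI := hH.integrable_compensatedHawkes hlam hμ hμi hμ1
  have hmin := fun i => integrable_min_sq_abs ((hI (u (i + 1))).sub (hI (u i))) hR
  simp only [Pi.sub_apply] at hmin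
  induction K with
  | zero =>
    have h0 : ∀ ω, compensatedHawkes lam μ N 0 ω = 0 := fun ω => by
      simp [compensatedHawkes, hH.counting.zero, hawkesCompensator_zero]
    simp [hu0, h0, Real.sqrt_sq hR.le]
  | succ K ih =>
    simp only [Finset.sum_range_succ]
    rw [integral_add (integrable_finsetSum _ fun i _ => hmin i) (hmin K), ← add_assoc]
    have hψ : Continuous fun x : ℝ => x / √(R ^ 2 + x ^ 2) := by
      refine continuous_id.div (by fun_prop) fun x => ?_
      positivity
    have hψ1 : ∀ x : ℝ, |x / √(R ^ 2 + x ^ 2)| ≤ 1 := fun x => by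
      rw [abs_div, abs_of_nonneg (Real.sqrt_nonneg _)]
      exact div_le_one_of_le₀ (Real.abs_le_sqrt (by nlinarith)) (Real.sqrt_nonneg _)
    have hz := hH.integral_mul_increment_eq_zero hlam hμ hμi hμ1 (hu K.le_succ) hψ hψ1
    have hzi : Integrable (fun ω => compensatedHawkes lam μ N (u K) ω /
        √(R ^ 2 + compensatedHawkes lam μ N (u K) ω ^ 2) *
        (compensatedHawkes lam μ N (u (K + 1)) ω - compensatedHawkes lam μ N (u K) ω)) P :=
      ((hI (u (K + 1))).sub (hI (u K))).bdd_mul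
        (hψ.comp_aestronglyMeasurable (hI (u K)).aestronglyMeasurable)
        (ae_of_all _ fun ω => hψ1 _)
    have hs := integrable_sqrt_sq_add_sq (hI (u K)) R
    have hstep := integral_mono (integrable_sqrt_sq_add_sq (hI (u (K + 1))) R)
      ((hs.add hzi).add (hmin K)) fun ω => sqrt_sq_add_sq_le hR
        (compensatedHawkes lam μ N (u K) ω) (compensatedHawkes lam μ N (u (K + 1)) ω)
    rw [integral_add' (hs.add hzi) (hmin K), integral_add' hs hzi, hz] at hstep
    linarith

/-- Along fine partitions the sum of the squared increments of `M` is essentially the number of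
jumps, since the compensator is continuous. -/
lemma eventually_sum_min_increment_le (hN : IsCountingProcess N) (hlam : 0 ≤ lam)
    (hμ : ∀ s, 0 ≤ s → 0 ≤ μ s) (hμi : IntegrableOn μ (Set.Ioi 0)) {R : ℝ} (hR : 0 < R)
    (t : ℝ≥0) (ω : Ω) :
    ∀ᶠ K : ℕ in atTop, ∑ i ∈ Finset.range K,
      min ((compensatedHawkes lam μ N ((i + 1 : ℕ) * (t / K)) ω -
        compensatedHawkes lam μ N (i * (t / K)) ω) ^ 2 / (2 * R))
        (2 * |compensatedHawkes lam μ N ((i + 1 : ℕ) * (t / K)) ω -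
        compensatedHawkes lam μ N (i * (t / K)) ω|) ≤ (N t ω + 1) / R := by
  set C := fun s => hawkesCompensator lam μ N s ω with hC
  have hCm : Monotone C := hawkesCompensator_mono hN hlam hμ hμi ω
  have hC0 : C 0 = 0 := hawkesCompensator_zero ω
  have hCt : 0 ≤ C t := hC0 ▸ hCm zero_le
  obtain ⟨δ, hδ, hNδ⟩ := hN.exists_apply_le_add_one ω t
  have huc := (isCompact_Icc (a := (0 : ℝ≥0)) (b := t)).uniformContinuousOn_of_continuous
    (continuous_hawkesCompensator (lam := lam) hN hμi ω).continuousOn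
  obtain ⟨δ', hδ', hCδ⟩ := Metric.uniformContinuousOn_iff.1 huc (1 / (C t + 1)) (by positivity)
  have hlim : Tendsto (fun K : ℕ => (t : ℝ) / K) atTop (𝓝 0) :=
    tendsto_const_nhds.div_atTop tendsto_natCast_atTop_atTop
  filter_upwards [hlim.eventually (gt_mem_nhds hδ), hlim.eventually (gt_mem_nhds hδ'),
    eventually_ge_atTop 1] with K h1 h2 hK
  have hK0 : (K : ℝ≥0) ≠ 0 := by positivity
  set u : ℕ → ℝ≥0 := fun i => i * (t / K) with hu
  have hum : Monotone u := fun i j hij => by simp only [hu]; gcongr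
  have huK : u K = t := by simp only [hu]; field_simp
  have hu0 : u 0 = 0 := by simp [hu]
  have hdist : ∀ i, dist (u i) (u (i + 1)) = t / K := fun i => by
    rw [dist_comm, NNReal.dist_eq]
    simp only [hu]
    push_cast
    rw [show ((i : ℝ) + 1) * (t / K) - i * (t / K) = t / K by ring, abs_of_nonneg (by positivity)]
  have hterm : ∀ i ∈ Finset.range K, min ((compensatedHawkes lam μ N (u (i + 1)) ω -
        compensatedHawkes lam μ N (u i) ω) ^ 2 / (2 * R))
        (2 * |compensatedHawkes lam μ N (u (i + 1)) ω - compensatedHawkes lam μ N (u i) ω|) ≤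
      1 / R * (((N (u (i + 1)) ω : ℝ) - N (u i) ω) +
        1 / (C t + 1) * (C (u (i + 1)) - C (u i))) := by
    intro i hi
    have hiK : i + 1 ≤ K := Finset.mem_range.1 hi
    have hle : u (i + 1) ≤ t := huK ▸ hum hiK
    have hle' : u i ≤ t := (hum i.le_succ).trans hle
    have hn1 : N (u (i + 1)) ω ≤ N (u i) ω + 1 := hNδ _ _ hle' (by rw [hdist]; exact h1)
    have hn2 : N (u i) ω ≤ N (u (i + 1)) ω := hN.mono ω (hum i.le_succ)
    have hc1 := hCδ (u i) ⟨zero_le, hle'⟩ (u (i + 1)) ⟨zero_le, hle⟩ (by rw [hdist]; exact h2)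
    have hc2 : C (u i) ≤ C (u (i + 1)) := hCm (hum i.le_succ)
    rw [dist_comm, Real.dist_eq, abs_of_nonneg (sub_nonneg.2 hc2)] at hc1
    have ha : (0 : ℝ) ≤ (N (u (i + 1)) ω : ℝ) - N (u i) ω := sub_nonneg.2 (by exact_mod_cast hn2)
    have ha' : (N (u (i + 1)) ω : ℝ) - N (u i) ω ≤ 1 := by
      rw [sub_le_iff_le_add']; exact_mod_cast hn1
    refine (min_le_left _ _).trans ?_
    rw [compensatedHawkes, compensatedHawkes]
    change ((N (u (i + 1)) ω - C (u (i + 1))) - (N (u i) ω - C (u i))) ^ 2 / (2 * R) ≤ _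
    have hb := sub_nonneg.2 hc2
    have hb' := hc1.le
    set a := (N (u (i + 1)) ω : ℝ) - N (u i) ω
    set b := C (u (i + 1)) - C (u i)
    set e := 1 / (C t + 1)
    rw [show (N (u (i + 1)) ω - C (u (i + 1))) - (N (u i) ω - C (u i)) = a - b by ring]
    have hsq : (a - b) ^ 2 ≤ 2 * (a + e * b) := by nlinarith [sq_nonneg (a + b)]
    calc (a - b) ^ 2 / (2 * R) ≤ 2 * (a + e * b) / (2 * R) := by gcongr
      _ = 1 / R * (a + e * b) := by field_simp
  refine (Finset.sum_le_sum hterm).trans ?_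
  rw [← Finset.mul_sum, Finset.sum_add_distrib, ← Finset.mul_sum,
    Finset.sum_range_sub (fun i => (N (u i) ω : ℝ)), Finset.sum_range_sub (fun i => C (u i)),
    huK, hu0, hC0, hN.zero]
  have : 1 / (C t + 1) * C t ≤ 1 := by
    rw [one_div, inv_mul_le_iff₀ (by positivity)]; linarith
  rw [one_div, inv_mul_eq_div]
  simp only [sub_zero, Nat.cast_zero]
  gcongr

/-- The quadratic variation of `M` is `N`. In terms of first moments this gives
`E |M(t)| ≤ R + (E N(t) + 1) / R` for every `R > 0`. -/
lemma IsHawkesProcess.integral_abs_compensatedHawkes_le (hH : IsHawkesProcess lam μ N P)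
    (hlam : 0 ≤ lam) (hμ : ∀ s, 0 ≤ s → 0 ≤ μ s) (hμi : IntegrableOn μ (Set.Ioi 0))
    (hμ1 : ∫ s in Set.Ioi (0 : ℝ), μ s < 1) {R : ℝ} (hR : 0 < R) (t : ℝ≥0) :
    ∫ ω, |compensatedHawkes lam μ N t ω| ∂P ≤ R + (∫ ω, (N t ω : ℝ) ∂P + 1) / R := by
  have hN := hH.counting
  have hI := hH.integrable_compensatedHawkes hlam hμ hμi hμ1
  have hNi := (hH.integrable_and_integral_le hlam hμ hμi hμ1 t).1
  have hCi := hH.integrable_hawkesCompensator hlam hμ hμi hμ1 t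
  set Z : ℕ → Ω → ℝ := fun K ω => ∑ i ∈ Finset.range K,
      min ((compensatedHawkes lam μ N ((i + 1 : ℕ) * (t / K)) ω -
        compensatedHawkes lam μ N (i * (t / K)) ω) ^ 2 / (2 * R))
        (2 * |compensatedHawkes lam μ N ((i + 1 : ℕ) * (t / K)) ω -
        compensatedHawkes lam μ N (i * (t / K)) ω|) with hZ
  have hZi : ∀ K, Integrable (Z K) P := fun K => integrable_finsetSum _ fun i _ => by
    simpa using integrable_min_sq_abs ((hI ((i + 1 : ℕ) * (t / K))).sub (hI (i * (t / K)))) hR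
  have hG : Integrable (fun ω => ((N t ω : ℝ) + 1) / R) P :=
    (hNi.add (integrable_const 1)).div_const R
  have hZ0 : ∀ K ω, 0 ≤ Z K ω := fun K ω => Finset.sum_nonneg fun i _ => by positivity
  have hG0 : ∀ ω, 0 ≤ ((N t ω : ℝ) + 1) / R := fun ω => by positivity
  -- All sums are dominated by twice the total variation of `M`.
  have hZle : ∀ K ≥ 1, ∀ ω, Z K ω ≤ 2 * (N t ω + hawkesCompensator lam μ N t ω) := by
    intro K hK ω
    have hK0 : (K : ℝ≥0) ≠ 0 := by positivity
    set u : ℕ → ℝ≥0 := fun i => i * (t / K) with hu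
    have hum : Monotone u := fun i j hij => by simp only [hu]; gcongr
    have huK : u K = t := by simp only [hu]; field_simp
    have hu0 : u 0 = 0 := by simp [hu]
    have hterm : ∀ i ∈ Finset.range K, min ((compensatedHawkes lam μ N (u (i + 1)) ω -
        compensatedHawkes lam μ N (u i) ω) ^ 2 / (2 * R))
        (2 * |compensatedHawkes lam μ N (u (i + 1)) ω - compensatedHawkes lam μ N (u i) ω|) ≤
        2 * (((N (u (i + 1)) ω : ℝ) - N (u i) ω) +
          (hawkesCompensator lam μ N (u (i + 1)) ω - hawkesCompensator lam μ N (u i) ω)) := by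
      intro i _
      refine (min_le_right _ _).trans ?_
      have h1 : (N (u i) ω : ℝ) ≤ N (u (i + 1)) ω := by exact_mod_cast hN.mono ω (hum i.le_succ)
      have h2 := hawkesCompensator_mono hN hlam hμ hμi ω (hum i.le_succ)
      simp only [Nat.succ_eq_add_one] at h2
      rw [compensatedHawkes, compensatedHawkes]
      gcongr
      rw [abs_le]
      constructor <;> linarith
    refine (Finset.sum_le_sum hterm).trans ?_
    rw [← Finset.mul_sum, Finset.sum_add_distrib, Finset.sum_range_sub (fun i => (N (u i) ω : ℝ)),
      Finset.sum_range_sub (fun i => hawkesCompensator lam μ N (u i) ω), huK, hu0,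
      hawkesCompensator_zero, hN.zero]
    simp
  have hlim : Tendsto (fun K => ∫ ω, max (Z K ω - (N t ω + 1) / R) 0 ∂P) atTop (𝓝 0) := by
    have := tendsto_integral_filter_of_dominated_convergence (μ := P) (l := atTop)
      (F := fun K ω => max (Z K ω - (N t ω + 1) / R) 0) (f := fun _ => (0 : ℝ))
      (fun ω => 2 * (N t ω + hawkesCompensator lam μ N t ω))
      (Eventually.of_forall fun K => ((hZi K).sub hG).pos_part.aestronglyMeasurable)
      ((eventually_ge_atTop 1).mono fun K hK => ae_of_all _ fun ω => by
        have h1 := hZle K hK ω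
        have h2 := hG0 ω
        have h3 := (hZ0 K ω).trans h1
        rw [Real.norm_of_nonneg (le_max_right _ _)]
        exact max_le (by linarith) h3)
      ((hNi.add hCi).const_mul 2)
      (ae_of_all _ fun ω => tendsto_const_nhds.congr' (by
        filter_upwards [eventually_sum_min_increment_le hN hlam hμ hμi hR t ω] with K hK
        exact (max_eq_right (sub_nonpos.2 hK)).symm))
    simpa using this
  have hbound : ∀ K ≥ 1, ∫ ω, |compensatedHawkes lam μ N t ω| ∂P ≤
      R + (∫ ω, (N t ω : ℝ) ∂P + 1) / R + ∫ ω, max (Z K ω - (N t ω + 1) / R) 0 ∂P := by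
    intro K hK
    have hK0 : (K : ℝ≥0) ≠ 0 := by positivity
    have h1 : ∫ ω, |compensatedHawkes lam μ N t ω| ∂P ≤
        ∫ ω, √(R ^ 2 + compensatedHawkes lam μ N t ω ^ 2) ∂P :=
      integral_mono (hI t).abs (integrable_sqrt_sq_add_sq (hI t) R) fun ω =>
        Real.abs_le_sqrt (by nlinarith)
    have h2 := hH.integral_sqrt_le_partition hlam hμ hμi hμ1 hR (u := fun i => i * (t / K))
      (fun i j hij => by dsimp only; gcongr) (by simp) K
    rw [show (K : ℝ≥0) * (t / K) = t by field_simp] at h2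
    have h3 : ∫ ω, Z K ω ∂P ≤ ∫ ω, ((N t ω + 1) / R + max (Z K ω - (N t ω + 1) / R) 0) ∂P :=
      integral_mono (hZi K) (hG.add ((hZi K).sub hG).pos_part) fun ω => by
        have := le_max_left (Z K ω - (N t ω + 1) / R) 0
        simp only
        linarith
    have hpos : Integrable (fun ω => max (Z K ω - (N t ω + 1) / R) 0) P :=
      ((hZi K).sub hG).pos_part
    rw [integral_add hG hpos, integral_div, integral_add hNi (integrable_const 1)] at h3
    simp only [integral_const, probReal_univ, smul_eq_mul, mul_one] at h3
    linarith
  have := ge_of_tendsto (hlim.const_add (R + (∫ ω, (N t ω : ℝ) ∂P + 1) / R))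
    ((eventually_ge_atTop 1).mono hbound)
  simpa using this

end MomentBound

/-! ### From sublinear first moments to uniform convergence in probability -/

section Probability

variable {Ω : Type*} [MeasurableSpace Ω] {P : Measure Ω} [IsProbabilityMeasure P]

/-- Markov's inequality for variables whose means grow sublinearly. -/
lemma tendsto_measureReal_lt_of_integral_le {f : ℕ → Ω → ℝ} (hf : ∀ n, Integrable (f n) P)
    (hf0 : ∀ n ω, 0 ≤ f n ω) (h : ∀ ε > 0, ∃ B, ∀ n : ℕ, ∫ ω, f n ω ∂P ≤ ε * n + B)
    {δ : ℝ} (hδ : 0 < δ) : Tendsto (fun n : ℕ => P.real {ω | δ * n < f n ω}) atTop (𝓝 0) := by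
  refine Metric.tendsto_atTop'.2 fun η hη => ?_
  obtain ⟨B, hB⟩ := h (δ * (η / 2)) (by positivity)
  have hlim : Tendsto (fun n : ℕ => B / δ / n) atTop (𝓝 0) :=
    tendsto_const_nhds.div_atTop tendsto_natCast_atTop_atTop
  obtain ⟨n₀, hn₀⟩ := eventually_atTop.1 (hlim.eventually (gt_mem_nhds (half_pos hη)))
  refine ⟨n₀, fun n hn => ?_⟩
  have hn0 : (0 : ℝ) < n := by exact_mod_cast (Nat.zero_le _).trans_lt hn
  have h1 := mul_meas_ge_le_integral_of_nonneg (μ := P) (ae_of_all _ (hf0 n)) (hf n) (δ * n)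
  have h2 : P.real {ω | δ * n < f n ω} ≤ P.real {ω | δ * n ≤ f n ω} :=
    measureReal_mono fun ω hω => le_of_lt (Set.mem_ofPred_eq ▸ hω)
  rw [Real.dist_0_eq_abs, abs_of_nonneg measureReal_nonneg]
  have h3 : P.real {ω | δ * n ≤ f n ω} ≤ η / 2 + B / δ / n := by
    have h4 : δ * n * P.real {ω | δ * n ≤ f n ω} ≤ δ * (η / 2) * n + B := h1.trans (hB n)
    have h5 : η / 2 + B / δ / n = (δ * (η / 2) * n + B) / (δ * n) := by field_simp
    rw [h5, le_div_iff₀ (by positivity)]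
    linarith
  linarith [hn₀ n hn.le]

/-- A finite union of events whose probabilities tend to `0`. -/
lemma tendsto_measureReal_of_subset_biUnion {A : ℕ → Set Ω} {B : ℕ → ℕ → Set Ω} (K : ℕ)
    (hAB : ∀ᶠ n in atTop, A n ⊆ ⋃ i ∈ Finset.range K, B i n)
    (hB : ∀ i, Tendsto (fun n => P.real (B i n)) atTop (𝓝 0)) :
    Tendsto (fun n => P.real (A n)) atTop (𝓝 0) := by
  have hsum : Tendsto (fun n => ∑ i ∈ Finset.range K, P.real (B i n)) atTop (𝓝 0) := by
    simpa using tendsto_finsetSum (Finset.range K) fun i _ => hB i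
  refine tendsto_of_tendsto_of_tendsto_of_le_of_le' tendsto_const_nhds hsum
    (Eventually.of_forall fun _ => measureReal_nonneg) (hAB.mono fun n hn => ?_)
  exact (measureReal_mono hn (measure_ne_top _ _)).trans (measureReal_biUnion_finset_le _ _)

/-- For monotone paths and a linear limit, convergence in probability at each time is uniform on
compact time intervals. -/
lemma tendsto_measureReal_exists_of_monotone {N : ℝ≥0 → Ω → ℕ}
    (hmono : ∀ ω, Monotone fun t => N t ω) {ρ : ℝ} (hρ : 0 ≤ ρ)
    (hN : ∀ (t : ℝ≥0) (δ : ℝ), 0 < δ →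
      Tendsto (fun n : ℕ => P.real {ω | δ * n < |(N (n * t) ω : ℝ) - ρ * (n * t)|}) atTop (𝓝 0))
    (T : ℝ≥0) {ε : ℝ} (hε : 0 < ε) :
    Tendsto (fun n : ℕ => P.real {ω | ∃ t ≤ T, ε * n < |(N (n * t) ω : ℝ) - ρ * (n * t)|})
      atTop (𝓝 0) := by
  obtain ⟨L, hL⟩ := exists_nat_gt (2 * ρ * T / ε)
  have hL0 : (0 : ℝ) < L := lt_of_le_of_lt (by positivity) hL
  have hL0' : (L : ℝ≥0) ≠ 0 := by intro h; simp [Nat.cast_eq_zero.1 h] at hL0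
  have hgap : ρ * (T / L) ≤ ε / 2 := by
    rw [div_lt_iff₀ hε] at hL
    rw [mul_div_assoc', div_le_iff₀ hL0]
    linarith
  refine tendsto_measureReal_of_subset_biUnion (L + 2)
    (B := fun i n => {ω | ε / 2 * n < |(N (n * (i * (T / L))) ω : ℝ) - ρ * (n * (i * (T / L)))|})
    (Eventually.of_forall fun n ω hω => ?_) fun i => by
      simpa using hN (i * (T / L)) (ε / 2) (half_pos hε)
  obtain ⟨t, htT, ht⟩ := hω
  simp only [Set.mem_iUnion, Finset.mem_range]
  by_contra! hcon
  rcases eq_or_ne T 0 with hT | hT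
  · have ht0 : t = 0 := le_antisymm (hT ▸ htT) zero_le
    have h0 := hcon 0 (by omega)
    simp only [Set.mem_ofPred_eq, not_lt] at h0
    simp only [ht0, mul_zero, NNReal.coe_zero, sub_zero] at ht
    simp only [Nat.cast_zero, zero_mul, mul_zero, sub_zero] at h0
    nlinarith [Nat.cast_nonneg (α := ℝ) n]
  have hTL : 0 < T / L := div_pos (pos_iff_ne_zero.2 hT) (pos_iff_ne_zero.2 hL0')
  set i := ⌊t / (T / L)⌋₊ with hi
  have hi1 : i * (T / L) ≤ t := by
    rw [← le_div_iff₀ hTL]; exact Nat.floor_le zero_le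
  have hi2 : t ≤ (i + 1 : ℕ) * (T / L) := by
    rw [← div_le_iff₀ hTL]
    push_cast
    exact (Nat.lt_floor_add_one _).le
  have hiL : i ≤ L := by
    have : (i : ℝ≥0) ≤ L := by
      refine (Nat.floor_le zero_le).trans ?_
      rw [div_le_iff₀ hTL, mul_div_cancel₀ _ hL0']
      exact htT
    exact_mod_cast this
  have h1 := hcon i (by omega)
  have h2 := hcon (i + 1) (by omega)
  simp only [Set.mem_ofPred_eq, not_lt, abs_le] at h1 h2
  have hm1 : (N (n * (i * (T / L))) ω : ℝ) ≤ N (n * t) ω := by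
    exact_mod_cast hmono ω (mul_le_mul_right hi1 _)
  have hm2 : (N (n * t) ω : ℝ) ≤ N (n * ((i + 1 : ℕ) * (T / L))) ω := by
    exact_mod_cast hmono ω (mul_le_mul_right hi2 _)
  have hr1 : (i * (T / L) : ℝ) ≤ t := by exact_mod_cast hi1
  have hr2 : (t : ℝ) ≤ (i + 1 : ℕ) * (T / L) := by exact_mod_cast hi2
  have hn : (0 : ℝ) ≤ n := by positivity
  have hn2 := mul_le_mul_of_nonneg_left hgap hn
  have hr1' := mul_le_mul_of_nonneg_left hr1 (mul_nonneg hρ hn)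
  have hr2' := mul_le_mul_of_nonneg_left hr2 (mul_nonneg hρ hn)
  push_cast at h1 h2 hr2' hm2
  refine absurd ht (not_lt.2 (abs_le.2 ⟨?_, ?_⟩)) <;> nlinarith

/-- For sequences with bounded increments and zero drift, convergence in probability is uniform
over linearly growing ranges of indices. -/
lemma tendsto_measureReal_exists_of_lipschitz {B : ℕ → Ω → ℝ} {c : ℝ} (hc : 0 < c)
    (hlip : ∀ m k ω, |B (m + k) ω - B m ω| ≤ c * k) (hBi : ∀ m, Integrable (B m) P)
    (hB : ∀ ε > 0, ∃ b, ∀ m : ℕ, ∫ ω, |B m ω| ∂P ≤ ε * m + b)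
    {K : ℝ} (hK : 0 ≤ K) {ε : ℝ} (hε : 0 < ε) :
    Tendsto (fun n : ℕ => P.real {ω | ∃ m : ℕ, m ≤ K * n ∧ ε * n < |B m ω|}) atTop (𝓝 0) := by
  -- Blocks of length `q n`, about `δ n`, over which `B` moves by less than `ε n / 2`.
  set δ := ε / (4 * c) with hδ
  have hδ0 : 0 < δ := by positivity
  set q : ℕ → ℕ := fun n => ⌊δ * n⌋₊ + 1 with hq
  have hq1 : ∀ n : ℕ, δ * n ≤ q n := fun n => by
    simp only [hq]; push_cast; exact (Nat.lt_floor_add_one _).le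
  have hq2 : ∀ n : ℕ, (q n : ℝ) ≤ δ * n + 1 := fun n => by
    simp only [hq]; push_cast; gcongr; exact Nat.floor_le (by positivity)
  refine tendsto_measureReal_of_subset_biUnion (⌊K / δ⌋₊ + 1)
    (B := fun i n => {ω | ε / 2 * n < |B (i * q n) ω|}) ?_ fun i => ?_
  · filter_upwards [eventually_ge_atTop ⌈1 / δ⌉₊, eventually_ge_atTop 1] with n hn hn1 ω hω
    obtain ⟨m, hm, hmB⟩ := hω
    have hn0 : (0 : ℝ) < n := by exact_mod_cast hn1
    have hδn : 1 ≤ δ * n := by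
      have := Nat.ceil_le.1 hn
      rwa [div_le_iff₀' hδ0] at this
    have hqpos : 0 < q n := Nat.succ_pos _
    simp only [Set.mem_iUnion, Finset.mem_range, exists_prop]
    refine ⟨m / q n, ?_, ?_⟩
    · refine Nat.lt_succ_of_le (Nat.le_floor ?_)
      refine (Nat.cast_div_le).trans ?_
      rw [div_le_div_iff₀ (by positivity) hδ0]
      calc (m : ℝ) * δ ≤ K * n * δ := by gcongr
        _ = K * (δ * n) := by ring
        _ ≤ K * q n := by gcongr; exact hq1 n
    · have hl := hlip (m / q n * q n) (m % q n) ω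
      rw [mul_comm (m / q n), Nat.div_add_mod] at hl
      have hmod : ((m % q n : ℕ) : ℝ) ≤ q n := by exact_mod_cast (Nat.mod_lt m hqpos).le
      have hbd : c * ((m % q n : ℕ) : ℝ) ≤ ε / 2 * n := by
        calc c * ((m % q n : ℕ) : ℝ) ≤ c * (δ * n + δ * n) := by
              gcongr; exact hmod.trans ((hq2 n).trans (by linarith))
          _ = ε / 2 * n := by rw [hδ]; field_simp; ring
      rw [Set.mem_ofPred_eq, mul_comm (m / q n)]
      have := abs_sub_abs_le_abs_sub (B m ω) (B (q n * (m / q n)) ω)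
      linarith
  · refine tendsto_measureReal_lt_of_integral_le (fun n => (hBi _).abs) (fun n ω => abs_nonneg _)
      (fun η hη => ?_) (half_pos hε)
    obtain ⟨b, hb⟩ := hB (η / ((i + 1) * δ)) (by positivity)
    refine ⟨η / ((i + 1) * δ) * i + b, fun n => (hb _).trans ?_⟩
    have : η / ((i + 1) * δ) * ((i * q n : ℕ) : ℝ) ≤ η * n + η / ((i + 1) * δ) * i := by
      push_cast
      calc η / ((i + 1) * δ) * (i * q n) ≤ η / ((i + 1) * δ) * (i * (δ * n + 1)) := by
            gcongr; exact hq2 n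
        _ = η * n * (i / (i + 1)) + η / ((i + 1) * δ) * i := by field_simp
        _ ≤ η * n * 1 + η / ((i + 1) * δ) * i := by
            gcongr; rw [div_le_one (by positivity)]; linarith
        _ = _ := by ring
    linarith

end Probability

/-! ### The law of large numbers for the Hawkes process -/

section HawkesLLN

variable {Ω : Type*} [MeasurableSpace Ω] {P : Measure Ω} [IsProbabilityMeasure P]
  {N : ℝ≥0 → Ω → ℕ} {μ : ℝ → ℝ} {lam : ℝ}

/-- Iterating `E N(t + u) ≥ λ (t + u) + F(u) E N(t)`. -/
lemma IsHawkesProcess.geom_sum_mul_le_integral (hH : IsHawkesProcess lam μ N P)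
    (hlam : 0 ≤ lam) (hμ : ∀ s, 0 ≤ s → 0 ≤ μ s) (hμi : IntegrableOn μ (Set.Ioi 0))
    (hμ1 : ∫ s in Set.Ioi (0 : ℝ), μ s < 1) (u t : ℝ≥0) (j : ℕ) :
    lam * (∑ i ∈ Finset.range j, integratedResponse μ u ^ i) * t ≤
      ∫ ω, (N (t + j * u) ω : ℝ) ∂P := by
  induction j with
  | zero => simpa using integral_nonneg fun ω => Nat.cast_nonneg _
  | succ j ih =>
    have hF := integratedResponse_nonneg hμ u
    have hi := (hH.integrable_and_integral_le hlam hμ hμi hμ1 (t + j * u)).1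
    have h : lam * (t + j * u + u : ℝ≥0) + integratedResponse μ u * ∫ ω, (N (t + j * u) ω : ℝ) ∂P
        ≤ ∫ ω, (N (t + j * u + u) ω : ℝ) ∂P := by
      rw [hH.integral_eq_integral_hawkesCompensator hlam hμ hμi hμ1 (t + j * u + u)]
      have := integral_mono ((integrable_const (lam * (t + j * u + u : ℝ≥0))).add (hi.const_mul _))
        (hH.integrable_hawkesCompensator hlam hμ hμi hμ1 (t + j * u + u))
        fun ω => le_hawkesCompensator hH.counting hμ hμi (t + j * u) u ω
      rw [integral_add' (integrable_const _) (hi.const_mul _), integral_const_mul] at this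
      simpa [integral_const_mul] using this
    rw [geom_sum_succ, Nat.cast_succ, add_mul, one_mul, ← add_assoc]
    refine le_trans ?_ h
    have h2 := mul_le_mul_of_nonneg_left ih hF
    push_cast
    have : 0 ≤ lam * (j * u + u) := by positivity
    linarith

/-- `E N(t) ≥ (ρ - ε) t - B`, where `ρ = λ / (1 - μ̂)`. -/
lemma IsHawkesProcess.exists_le_integral (hH : IsHawkesProcess lam μ N P)
    (hlam : 0 ≤ lam) (hμ : ∀ s, 0 ≤ s → 0 ≤ μ s) (hμi : IntegrableOn μ (Set.Ioi 0))
    (hμ1 : ∫ s in Set.Ioi (0 : ℝ), μ s < 1) {ε : ℝ} (hε : 0 < ε) :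
    ∃ B, ∀ t : ℝ≥0, (lam / (1 - ∫ s in Set.Ioi (0 : ℝ), μ s) - ε) * t - B ≤
      ∫ ω, (N t ω : ℝ) ∂P := by
  set mh := ∫ s in Set.Ioi (0 : ℝ), μ s with hmh
  have hlim1 : Tendsto (fun u => lam / (1 - integratedResponse μ u)) atTop
      (𝓝 (lam / (1 - mh))) :=
    tendsto_const_nhds.div (tendsto_const_nhds.sub (tendsto_integratedResponse hμi))
      (by linarith)
  obtain ⟨u, hu, hu0⟩ := ((hlim1.eventually (lt_mem_nhds (sub_lt_self _ hε))).and
    (eventually_ge_atTop 0)).exists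
  have hF0 := integratedResponse_nonneg hμ u
  have hF1 : integratedResponse μ u < 1 := (integratedResponse_le hμ hμi u).trans_lt hμ1
  have hlim2 : Tendsto (fun j => lam * ∑ i ∈ Finset.range j, integratedResponse μ u ^ i) atTop
      (𝓝 (lam / (1 - integratedResponse μ u))) := by
    rw [div_eq_mul_inv]
    exact (hasSum_geometric_of_lt_one hF0 hF1).tendsto_sum_nat.const_mul lam
  obtain ⟨j, hj⟩ := (hlim2.eventually (lt_mem_nhds hu)).exists
  set a := lam * ∑ i ∈ Finset.range j, integratedResponse μ u ^ i with ha
  have ha0 : 0 ≤ a := mul_nonneg hlam (Finset.sum_nonneg fun i _ => pow_nonneg hF0 i)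
  lift u to ℝ≥0 using hu0
  refine ⟨a * (j * u), fun t => ?_⟩
  have h1 : (lam / (1 - mh) - ε) * t ≤ a * t := by gcongr
  rcases le_total (j * u) t with h | h
  · obtain ⟨s, rfl⟩ := exists_add_of_le h
    have h2 := hH.geom_sum_mul_le_integral hlam hμ hμi hμ1 u s j
    rw [← ha, add_comm s] at h2
    push_cast at h1 ⊢
    linarith
  · have h2 : (0 : ℝ) ≤ ∫ ω, (N t ω : ℝ) ∂P := integral_nonneg fun ω => Nat.cast_nonneg _
    have h3 : (t : ℝ) ≤ j * u := by exact_mod_cast h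
    have h4 := mul_le_mul_of_nonneg_left h3 ha0
    linarith

/-- The law of large numbers in mean: `E |N(t) - ρ t| ≤ ε t + B`. It follows from `E N(t) ≈ ρ t`
and the one-sided pathwise bound `N(t) - ρ t ≤ M(t) / (1 - μ̂)`. -/
lemma IsHawkesProcess.exists_integral_abs_sub_le (hH : IsHawkesProcess lam μ N P)
    (hlam : 0 ≤ lam) (hμ : ∀ s, 0 ≤ s → 0 ≤ μ s) (hμi : IntegrableOn μ (Set.Ioi 0))
    (hμ1 : ∫ s in Set.Ioi (0 : ℝ), μ s < 1) {ε : ℝ} (hε : 0 < ε) :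
    ∃ B, ∀ t : ℝ≥0, ∫ ω, |(N t ω : ℝ) - lam / (1 - ∫ s in Set.Ioi (0 : ℝ), μ s) * t| ∂P ≤
      ε * t + B := by
  obtain ⟨B, hB⟩ := hH.exists_le_integral hlam hμ hμi hμ1 (half_pos hε)
  have hp : 0 < 1 - ∫ s in Set.Ioi (0 : ℝ), μ s := by linarith
  have hMle := fun t ω => le_compensatedHawkes (lam := lam) hH.counting hμ hμi t ω
  have hE := fun t => (hH.integrable_and_integral_le hlam hμ hμi hμ1 t).2
  set p := 1 - ∫ s in Set.Ioi (0 : ℝ), μ s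
  set ρ := lam / p with hρ
  have hρ0 : 0 ≤ ρ := by positivity
  -- With this `R` the term `2 / p * (E N(t) / R)` is at most `ε / 2 * t`.
  set R := 4 * (ρ + 1) / (p * ε) with hR
  have hR0 : 0 < R := by positivity
  refine ⟨2 / p * (R + 1 / R) + B, fun t => ?_⟩
  have hNi := (hH.integrable_and_integral_le hlam hμ hμi hμ1 t).1
  have hMi := (hH.integrable_compensatedHawkes hlam hμ hμi hμ1 t).abs
  -- `|x| = 2 x⁺ - x` with `x = N(t) - ρ t`: only the positive part needs a pathwise bound.
  have hpt : ∀ ω, |(N t ω : ℝ) - ρ * t| ≤ 2 / p * |compensatedHawkes lam μ N t ω| +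
      (ρ * t - N t ω) := by
    intro ω
    have h0 : 0 ≤ 2 / p * |compensatedHawkes lam μ N t ω| := by positivity
    have h1 : (N t ω : ℝ) - ρ * t ≤ 1 / p * |compensatedHawkes lam μ N t ω| := by
      have h2 := (hMle t ω).trans (add_le_add_left (le_abs_self _) _)
      have h3 : (N t ω : ℝ) - ρ * t = 1 / p * (p * N t ω - lam * t) := by rw [hρ]; field_simp
      rw [h3]
      gcongr
      linarith
    rw [abs_le]
    constructor
    · linarith
    · have : 2 / p * |compensatedHawkes lam μ N t ω| =
        2 * (1 / p * |compensatedHawkes lam μ N t ω|) := by ring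
      linarith
  have h1 := integral_mono (hNi.sub (integrable_const (ρ * t))).abs
    ((hMi.const_mul (2 / p)).add ((integrable_const (ρ * t)).sub hNi)) hpt
  rw [integral_add' (hMi.const_mul _) ((integrable_const _).sub hNi),
    integral_sub' (integrable_const _) hNi, integral_const_mul] at h1
  simp only [Pi.sub_apply, integral_const, probReal_univ, smul_eq_mul, one_mul] at h1
  have h2 := hH.integral_abs_compensatedHawkes_le hlam hμ hμi hμ1 hR0 t
  have h3 : R + (∫ ω, (N t ω : ℝ) ∂P + 1) / R ≤ R + ((ρ + 1) * t + 1) / R := by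
    gcongr
    exact (hE t).trans (by gcongr; linarith)
  have h4 := mul_le_mul_of_nonneg_left (h2.trans h3) (show 0 ≤ 2 / p by positivity)
  have h5 : 2 / p * (R + ((ρ + 1) * t + 1) / R) = 2 / p * (R + 1 / R) + ε / 2 * t := by
    have : (ρ + 1) / R = p * ε / 4 := by rw [hR]; field_simp
    rw [add_div, mul_div_right_comm, this]
    field_simp
    ring
  linarith [hB t]

lemma IsHawkesProcess.tendsto_measureReal_exists (hH : IsHawkesProcess lam μ N P)
    (hlam : 0 ≤ lam) (hμ : ∀ s, 0 ≤ s → 0 ≤ μ s) (hμi : IntegrableOn μ (Set.Ioi 0))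
    (hμ1 : ∫ s in Set.Ioi (0 : ℝ), μ s < 1) (T : ℝ≥0) {ε : ℝ} (hε : 0 < ε) :
    Tendsto (fun n : ℕ => P.real {ω | ∃ t ≤ T, ε * n <
      |(N (n * t) ω : ℝ) - lam / (1 - ∫ s in Set.Ioi (0 : ℝ), μ s) * (n * t)|}) atTop (𝓝 0) := by
  have hp : 0 < 1 - ∫ s in Set.Ioi (0 : ℝ), μ s := by linarith
  refine tendsto_measureReal_exists_of_monotone hH.counting.mono (by positivity)
    (fun t δ hδ => ?_) T hε
  refine tendsto_measureReal_lt_of_integral_le (fun n => ?_) (fun n ω => abs_nonneg _)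
    (fun η hη => ?_) hδ
  · exact ((hH.integrable_and_integral_le hlam hμ hμi hμ1 (n * t)).1.sub (integrable_const _)).abs
  · obtain ⟨B, hB⟩ := hH.exists_integral_abs_sub_le hlam hμ hμi hμ1
      (ε := η / (t + 1)) (by positivity)
    refine ⟨B, fun n => ?_⟩
    have h := hB (n * t)
    push_cast at h
    have h1 : η / (t + 1) * (n * t) ≤ η * n := by
      rw [div_mul_eq_mul_div, div_le_iff₀ (by positivity)]
      have : 0 ≤ η * n := by positivity
      nlinarith
    exact h.trans (by gcongr)

/-- Almost surely there are infinitely many arrivals. -/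
lemma IsHawkesProcess.ae_exists_le (hH : IsHawkesProcess lam μ N P)
    (hlam : 0 < lam) (hμ : ∀ s, 0 ≤ s → 0 ≤ μ s) (hμi : IntegrableOn μ (Set.Ioi 0))
    (hμ1 : ∫ s in Set.Ioi (0 : ℝ), μ s < 1) : ∀ᵐ ω ∂P, ∀ k, ∃ t, k ≤ N t ω := by
  rw [ae_all_iff]
  intro k
  have hp : 0 < 1 - ∫ s in Set.Ioi (0 : ℝ), μ s := by linarith
  set ρ := lam / (1 - ∫ s in Set.Ioi (0 : ℝ), μ s) with hρ
  have hρ0 : 0 < ρ := by positivity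
  have hlim := hH.tendsto_measureReal_exists hlam.le hμ hμi hμ1 1 (half_pos hρ0)
  rw [ae_iff, ← measureReal_eq_zero_iff]
  refine le_antisymm (ge_of_tendsto hlim ?_) measureReal_nonneg
  have hbig : ∀ᶠ n : ℕ in atTop, (k : ℝ) < ρ / 2 * n :=
    (tendsto_natCast_atTop_atTop.const_mul_atTop (half_pos hρ0)).eventually_gt_atTop _
  filter_upwards [hbig] with n hn
  refine measureReal_mono fun ω hω => ?_
  simp only [Set.mem_ofPred_eq, not_exists, not_le] at hω ⊢
  refine ⟨1, le_rfl, ?_⟩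
  have h1 : (N (n * 1) ω : ℝ) < k := by exact_mod_cast hω _
  simp only [← hρ, NNReal.coe_one, mul_one] at h1 ⊢
  refine lt_abs.2 (Or.inr ?_)
  linarith

end HawkesLLN

/-! ### The law of large numbers for a finite Markov chain -/

section Poisson

variable {d : ℕ} {Q : Matrix (Fin d) (Fin d) ℝ}

/-- Maximum principle: harmonic functions of an irreducible chain are constant. -/
lemma eq_of_mulVec_eq_self (hQ : Q.IsIrreducible) (hs : Q ∈ Matrix.rowStochastic ℝ (Fin d))
    {h : Fin d → ℝ} (hh : Q *ᵥ h = h) (i j : Fin d) : h i = h j := by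
  have : Nonempty (Fin d) := ⟨i⟩
  obtain ⟨i₀, hi₀⟩ := Finite.exists_max h
  suffices H : ∀ j, h j = h i₀ by rw [H i, H j]
  intro j
  obtain ⟨k, -, hk⟩ := (Matrix.isIrreducible_iff_exists_pow_pos hQ.nonneg).1 hQ i₀ j
  have hsk := pow_mem hs k
  have hhk : (Q ^ k) *ᵥ h = h := by
    clear hsk hk
    induction k with
    | zero => simp
    | succ k ih => rw [pow_succ, ← Matrix.mulVec_mulVec, hh, ih]
  have hsum : ∑ j, (Q ^ k) i₀ j * (h i₀ - h j) = 0 := by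
    have h1 := congrFun hhk i₀
    simp only [Matrix.mulVec, dotProduct] at h1
    simp only [mul_sub, Finset.sum_sub_distrib, ← Finset.sum_mul,
      Matrix.sum_row_of_mem_rowStochastic hsk, h1, one_mul, sub_self]
  have h2 := (Finset.sum_eq_zero_iff_of_nonneg fun j _ => mul_nonneg
    (Matrix.nonneg_of_mem_rowStochastic hsk) (sub_nonneg.2 (hi₀ j))).1 hsum j (Finset.mem_univ j)
  have := (mul_eq_zero.1 h2).resolve_left hk.ne'
  linarith

/-- The Poisson equation `g - Q g = a - π(a)` of an irreducible chain is solvable: the range of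
`1 - Q` lies in the kernel of `π`, and both have codimension one. -/
lemma exists_poisson_solution (hQ : Q.IsIrreducible) (hs : Q ∈ Matrix.rowStochastic ℝ (Fin d))
    {π : Fin d → ℝ} (hπ : π ∈ stdSimplex ℝ (Fin d)) (hπQ : π ᵥ* Q = π) (a : Fin d → ℝ) :
    ∃ g : Fin d → ℝ, ∀ i, a i - ∑ j, π j * a j = g i - (Q *ᵥ g) i := by
  let L : (Fin d → ℝ) →ₗ[ℝ] (Fin d → ℝ) := (1 - Q).mulVecLin
  let φ : (Fin d → ℝ) →ₗ[ℝ] ℝ := dotProductBilin ℝ ℝ π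
  have hL : ∀ g, L g = g - Q *ᵥ g := fun g => by
    simp only [L, Matrix.mulVecLin_apply, Matrix.sub_mulVec, Matrix.one_mulVec]
  have hφ : ∀ f, φ f = π ⬝ᵥ f := fun f => rfl
  have hπ1 : ∑ i, π i = 1 := hπ.2
  have hφ1 : φ 1 = 1 := by rw [hφ, dotProduct_one, hπ1]
  have hle : L.range ≤ φ.ker := by
    rintro _ ⟨g, rfl⟩
    rw [LinearMap.mem_ker, hφ, hL, dotProduct_sub, Matrix.dotProduct_mulVec, hπQ, sub_self]
  have hkL : Module.finrank ℝ L.ker ≤ 1 := by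
    refine finrank_le_one ⟨1, ?_⟩ fun w => ?_
    · rw [LinearMap.mem_ker, hL, Matrix.one_vecMul_of_mem_rowStochastic hs, sub_self]
    · have hw : Q *ᵥ w.1 = w.1 := by
        have := w.2
        rw [LinearMap.mem_ker, hL, sub_eq_zero] at this
        exact this.symm
      rcases isEmpty_or_nonempty (Fin d) with he | ⟨⟨i⟩⟩
      · exact ⟨0, Subsingleton.elim _ _⟩
      · refine ⟨w.1 i, Subtype.ext (funext fun j => ?_)⟩
        simpa using eq_of_mulVec_eq_self hQ hs hw i j
  have hφr : Module.finrank ℝ φ.range = 1 := by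
    have : φ.range = ⊤ := LinearMap.range_eq_top.2 fun x => ⟨x • 1, by simp [hφ1]⟩
    rw [this, finrank_top, Module.finrank_self]
  have h1 := L.finrank_range_add_finrank_ker
  have h2 := φ.finrank_range_add_finrank_ker
  have heq := Submodule.eq_of_le_of_finrank_le hle (by omega)
  have hmem : a - (∑ j, π j * a j) • (1 : Fin d → ℝ) ∈ L.range := by
    rw [heq, LinearMap.mem_ker, map_sub, map_smul, hφ1, hφ]
    simp [dotProduct]
  obtain ⟨g, hg⟩ := hmem
  refine ⟨g, fun i => ?_⟩
  have := congrFun hg i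
  rw [hL] at this
  simpa using this.symm

end Poisson

section MarkovLLN

variable {Ω : Type*} [MeasurableSpace Ω] {P : Measure Ω} [IsProbabilityMeasure P]
  {d : ℕ} {Q : Matrix (Fin d) (Fin d) ℝ} {X : ℕ → Ω → Fin d}

lemma integrable_comp_of_finite {α : Type*} [Finite α] [MeasurableSpace α]
    [MeasurableSingletonClass α] {W : Ω → α} (hW : Measurable W) (F : α → ℝ) :
    Integrable (fun ω => F (W ω)) P :=
  (Integrable.of_finite (μ := P.map W) (f := F)).comp_measurable hW

/-- The increment `g(X_{m+1}) - (Q g)(X_m)` is orthogonal to every function of `X_0, …, X_m`. -/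
lemma IsMarkovChain.integral_mul_increment_eq_zero (hX : IsMarkovChain Q X P) (g : Fin d → ℝ)
    (m : ℕ) (φ : (Fin (m + 1) → Fin d) → ℝ) :
    ∫ ω, φ (fun i => X i ω) * (g (X (m + 1) ω) - (Q *ᵥ g) (X m ω)) ∂P = 0 := by
  let W : Ω → (Fin (m + 1) → Fin d) × Fin d := fun ω => (fun i => X i ω, X (m + 1) ω)
  have hZ : Measurable fun ω => fun i : Fin (m + 1) => X i ω :=
    measurable_pi_lambda _ fun i => hX.measurable i
  have hW : Measurable W := hZ.prodMk (hX.measurable (m + 1))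
  let F : (Fin (m + 1) → Fin d) × Fin d → ℝ := fun p =>
    φ p.1 * (g p.2 - (Q *ᵥ g) (p.1 (Fin.last m)))
  have h1 : ∫ ω, φ (fun i => X i ω) * (g (X (m + 1) ω) - (Q *ᵥ g) (X m ω)) ∂P
      = ∫ p, F p ∂(P.map W) :=
    (integral_map hW.aemeasurable (measurable_of_finite F).aestronglyMeasurable).symm
  rw [h1, integral_fintype (Integrable.of_finite), Fintype.sum_prod_type]
  refine Finset.sum_eq_zero fun z _ => ?_
  have hmass : ∀ j, (P.map W).real {(z, j)} =
      P.real {ω | ∀ i : Fin (m + 1), X i ω = z i} * Q (z (Fin.last m)) j := by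
    intro j
    let x : ℕ → Fin d := fun i => if h : i < m + 1 then z ⟨i, h⟩ else j
    have hx : ∀ i : Fin (m + 1), x i = z i := fun i => dif_pos i.2
    have hxm : x (m + 1) = j := by simp [x]
    have hk := hX.markov m x
    have e1 : {ω | ∀ i ≤ m, X i ω = x i} = {ω | ∀ i : Fin (m + 1), X i ω = z i} := by
      ext ω
      refine ⟨fun h i => (h i (Nat.lt_succ_iff.1 i.2)).trans (hx i), fun h i hi => ?_⟩
      exact (h ⟨i, Nat.lt_succ_iff.2 hi⟩).trans (hx ⟨i, Nat.lt_succ_iff.2 hi⟩).symm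
    have e2 : {ω | ∀ i ≤ m + 1, X i ω = x i} = W ⁻¹' {(z, j)} := by
      ext ω
      simp only [Set.mem_ofPred_eq, Set.mem_preimage, Set.mem_singleton_iff, W, Prod.mk.injEq,
        funext_iff]
      refine ⟨fun h => ⟨fun i => (h i (by omega)).trans (hx i), (h _ le_rfl).trans hxm⟩, ?_⟩
      rintro ⟨h, h'⟩ i hi
      rcases Nat.lt_or_eq_of_le hi with hi | rfl
      · exact (h ⟨i, hi⟩).trans (hx ⟨i, hi⟩).symm
      · exact h'.trans hxm.symm
    rw [map_measureReal_apply hW (measurableSet_singleton _), ← e2, hk, e1, hxm]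
    congr 2
    exact hx (Fin.last m)
  simp only [hmass, F, smul_eq_mul]
  have hsum := Matrix.sum_row_of_mem_rowStochastic hX.stochastic (z (Fin.last m))
  calc ∑ j, P.real {ω | ∀ i : Fin (m + 1), X i ω = z i} * Q (z (Fin.last m)) j *
        (φ z * (g j - (Q *ᵥ g) (z (Fin.last m))))
      = P.real {ω | ∀ i : Fin (m + 1), X i ω = z i} * φ z *
        (∑ j, Q (z (Fin.last m)) j * g j -
          (∑ j, Q (z (Fin.last m)) j) * (Q *ᵥ g) (z (Fin.last m))) := by
        rw [Finset.sum_mul, ← Finset.sum_sub_distrib, Finset.mul_sum]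
        exact Finset.sum_congr rfl fun j _ => by ring
    _ = 0 := by
        rw [hsum, one_mul]
        simp [Matrix.mulVec, dotProduct]

/-- Orthogonality of the increments bounds the second moment of the martingale attached to `g`. -/
lemma IsMarkovChain.integral_sum_increment_sq_le (hX : IsMarkovChain Q X P) (g : Fin d → ℝ)
    {c : ℝ} (hc : ∀ i j, |g i - (Q *ᵥ g) j| ≤ c) (m : ℕ) :
    Integrable (fun ω => ∑ k ∈ Finset.range m, (g (X (k + 1) ω) - (Q *ᵥ g) (X k ω))) P ∧
    Integrable (fun ω => (∑ k ∈ Finset.range m, (g (X (k + 1) ω) - (Q *ᵥ g) (X k ω))) ^ 2) P ∧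
    ∫ ω, (∑ k ∈ Finset.range m, (g (X (k + 1) ω) - (Q *ᵥ g) (X k ω))) ^ 2 ∂P ≤ c ^ 2 * m := by
  have hpath : ∀ m, Measurable fun ω => fun i : Fin (m + 1) => X i ω :=
    fun m => measurable_pi_lambda _ fun i => hX.measurable i
  let φ : (m : ℕ) → (Fin (m + 1) → Fin d) → ℝ := fun m z =>
    ∑ k ∈ Finset.range m, (g (z (Fin.ofNat (m + 1) (k + 1))) - (Q *ᵥ g) (z (Fin.ofNat (m + 1) k)))
  have hφ : ∀ m ω, ∑ k ∈ Finset.range m, (g (X (k + 1) ω) - (Q *ᵥ g) (X k ω)) =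
      φ m fun i => X i ω := by
    intro m ω
    refine Finset.sum_congr rfl fun k hk => ?_
    have hk := Finset.mem_range.1 hk
    simp only [Fin.val_ofNat]
    rw [Nat.mod_eq_of_lt (by omega), Nat.mod_eq_of_lt (by omega)]
  have hI : ∀ m, Integrable
      (fun ω => ∑ k ∈ Finset.range m, (g (X (k + 1) ω) - (Q *ᵥ g) (X k ω))) P := fun m => by
    simp only [hφ]
    exact integrable_comp_of_finite (hpath m) (φ m)
  have hI2 : ∀ m, Integrable
      (fun ω => (∑ k ∈ Finset.range m, (g (X (k + 1) ω) - (Q *ᵥ g) (X k ω))) ^ 2) P := fun m => by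
    simp only [hφ]
    exact integrable_comp_of_finite (hpath m) fun z => φ m z ^ 2
  refine ⟨hI m, hI2 m, ?_⟩
  induction m with
  | zero => simp
  | succ m ih =>
    have hz := hX.integral_mul_increment_eq_zero g m (φ m)
    simp only [← hφ] at hz
    have hzi : Integrable (fun ω => (∑ k ∈ Finset.range m,
        (g (X (k + 1) ω) - (Q *ᵥ g) (X k ω))) * (g (X (m + 1) ω) - (Q *ᵥ g) (X m ω))) P := by
      simp only [hφ]
      exact integrable_comp_of_finite ((hpath m).prodMk ((hX.measurable (m + 1)).prodMk
        (hX.measurable m))) fun p => φ m p.1 * (g p.2.1 - (Q *ᵥ g) p.2.2)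
    have hstep := integral_mono (hI2 (m + 1))
      (((hI2 m).add (hzi.const_mul 2)).add (integrable_const (c ^ 2))) fun ω => by
        have h1 := sq_le_sq' (abs_le.1 (hc (X (m + 1) ω) (X m ω))).1
          (abs_le.1 (hc (X (m + 1) ω) (X m ω))).2
        simp only [Finset.sum_range_succ, Pi.add_apply]
        nlinarith
    rw [integral_add' ((hI2 m).add (hzi.const_mul 2)) (integrable_const _),
      integral_add' (hI2 m) (hzi.const_mul 2), integral_const_mul, hz] at hstep
    simp only [integral_const, probReal_univ, smul_eq_mul, one_mul] at hstep
    push_cast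
    linarith

/-- The law of large numbers in mean for additive functionals of an irreducible chain. -/
lemma IsMarkovChain.exists_integral_abs_le (hX : IsMarkovChain Q X P) (hQ : Q.IsIrreducible)
    {π : Fin d → ℝ} (hπ : π ∈ stdSimplex ℝ (Fin d)) (hπQ : π ᵥ* Q = π) (a : Fin d → ℝ) :
    (∀ m : ℕ, Integrable (fun ω => ∑ k ∈ Finset.Icc 1 m, (a (X k ω) - ∑ i, π i * a i)) P) ∧
    ∀ ε > 0, ∃ b, ∀ m : ℕ,
      ∫ ω, |∑ k ∈ Finset.Icc 1 m, (a (X k ω) - ∑ i, π i * a i)| ∂P ≤ ε * m + b := by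
  obtain ⟨g, hg⟩ := exists_poisson_solution hQ hX.stochastic hπ hπQ a
  obtain ⟨c, hc⟩ := Finite.exists_le fun p : Fin d × Fin d => |g p.1 - (Q *ᵥ g) p.2|
  obtain ⟨b, hb⟩ := Finite.exists_le fun p : Fin d × Fin d => |(Q *ᵥ g) p.1 - (Q *ᵥ g) p.2|
  -- Abel summation turns the functional into a martingale plus a boundary term.
  have hdecomp : ∀ m ω, ∑ k ∈ Finset.Icc 1 m, (a (X k ω) - ∑ i, π i * a i) =
      ∑ k ∈ Finset.range m, (g (X (k + 1) ω) - (Q *ᵥ g) (X k ω)) +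
        ((Q *ᵥ g) (X 0 ω) - (Q *ᵥ g) (X m ω)) := by
    intro m ω
    induction m with
    | zero => simp
    | succ m ih =>
      rw [Finset.sum_Icc_succ_top (by omega), ih, Finset.sum_range_succ, hg]
      ring
  have hmart := hX.integral_sum_increment_sq_le g fun i j => hc (i, j)
  have hbd : ∀ m, Integrable (fun ω => (Q *ᵥ g) (X 0 ω) - (Q *ᵥ g) (X m ω)) P := fun m =>
    (integrable_comp_of_finite (hX.measurable 0) _).sub
      (integrable_comp_of_finite (hX.measurable m) _)
  refine ⟨fun m => ?_, fun ε hε => ?_⟩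
  · simp only [hdecomp]
    exact (hmart m).1.add (hbd m)
  · set R := c ^ 2 / ε + 1 with hR
    have hR0 : 0 < R := by positivity
    refine ⟨R + b, fun m => ?_⟩
    have hpt : ∀ ω, |∑ k ∈ Finset.Icc 1 m, (a (X k ω) - ∑ i, π i * a i)| ≤
        (∑ k ∈ Finset.range m, (g (X (k + 1) ω) - (Q *ᵥ g) (X k ω))) ^ 2 / R + (R + b) := by
      intro ω
      rw [hdecomp]
      set D := ∑ k ∈ Finset.range m, (g (X (k + 1) ω) - (Q *ᵥ g) (X k ω))
      have h1 : |D| ≤ D ^ 2 / R + R := by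
        have h2 : D ^ 2 / R + R = (D ^ 2 + R ^ 2) / R := by field_simp
        rw [h2, le_div_iff₀ hR0]
        nlinarith [sq_nonneg (|D| - R), sq_abs D, abs_nonneg D]
      have h2 : |(Q *ᵥ g) (X 0 ω) - (Q *ᵥ g) (X m ω)| ≤ b := hb (X 0 ω, X m ω)
      have h3 := abs_add_le D ((Q *ᵥ g) (X 0 ω) - (Q *ᵥ g) (X m ω))
      linarith
    have hint : Integrable
        (fun ω => |∑ k ∈ Finset.Icc 1 m, (a (X k ω) - ∑ i, π i * a i)|) P := by
      simp only [hdecomp]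
      exact ((hmart m).1.add (hbd m)).abs
    have h1 := integral_mono hint (((hmart m).2.1.div_const R).add (integrable_const (R + b))) hpt
    rw [integral_add' ((hmart m).2.1.div_const R) (integrable_const _), integral_div] at h1
    simp only [integral_const, probReal_univ, smul_eq_mul, one_mul] at h1
    have h2 : (∫ ω, (∑ k ∈ Finset.range m, (g (X (k + 1) ω) - (Q *ᵥ g) (X k ω))) ^ 2 ∂P) / R ≤
        ε * m := by
      rw [div_le_iff₀ hR0]
      refine (hmart m).2.2.trans ?_
      have : c ^ 2 ≤ ε * R := by
        rw [hR, mul_add, mul_div_cancel₀ _ hε.ne']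
        linarith
      calc c ^ 2 * m ≤ ε * R * m := by gcongr
        _ = ε * m * R := by ring
    linarith

/-- The law of large numbers for additive functionals, uniformly over linearly growing ranges. -/
lemma IsMarkovChain.tendsto_measureReal_exists (hX : IsMarkovChain Q X P) (hQ : Q.IsIrreducible)
    {π : Fin d → ℝ} (hπ : π ∈ stdSimplex ℝ (Fin d)) (hπQ : π ᵥ* Q = π) (a : Fin d → ℝ)
    {K : ℝ} (hK : 0 ≤ K) {ε : ℝ} (hε : 0 < ε) :
    Tendsto (fun n : ℕ => P.real {ω | ∃ m : ℕ, m ≤ K * n ∧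
      ε * n < |∑ k ∈ Finset.Icc 1 m, (a (X k ω) - ∑ i, π i * a i)|}) atTop (𝓝 0) := by
  obtain ⟨hi, hb⟩ := hX.exists_integral_abs_le hQ hπ hπQ a
  obtain ⟨c, hc⟩ := Finite.exists_le fun j => |a j - ∑ i, π i * a i|
  refine tendsto_measureReal_exists_of_lipschitz
    (B := fun m ω => ∑ k ∈ Finset.Icc 1 m, (a (X k ω) - ∑ i, π i * a i))
    (c := max c 1) (by positivity) (fun m k ω => ?_) hi hb hK hε
  induction k with
  | zero => simp
  | succ k ih =>
    rw [← add_assoc, Finset.sum_Icc_succ_top (by omega), add_sub_right_comm]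
    refine (abs_add_le _ _).trans ?_
    push_cast
    have := (hc (X (m + k + 1) ω)).trans (le_max_left c 1)
    linarith

end MarkovLLN

/-! ### Time changes and measurability of the rescaled path -/

/-- Times `s_0 = 0 < s_1 < … < s_m` are carried to any nearby times `s'_0 = 0, s'_1, …, s'_m` by a
time change close to the identity. It has the form `t ↦ t + φ(t)`, where `φ` is a Lipschitz
extension of `s_k ↦ s'_k - s_k` with constant `1 / 2`. -/
lemma exists_timeChange {m : ℕ} {s : ℕ → ℝ≥0} (hs0 : s 0 = 0)
    (hs : ∀ j k, j < k → k ≤ m → s j < s k) {ε : ℝ} (hε : 0 < ε) :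
    ∃ η > 0, ∀ s' : ℕ → ℝ≥0, s' 0 = 0 → (∀ k ≤ m, dist (s' k) (s k) < η) →
      ∃ α : ℝ≥0 ≃o ℝ≥0, (∀ t, dist (α t) t < ε) ∧ ∀ k ≤ m, α (s k) = s' k := by
  have hgap : ∃ γ > (0 : ℝ), ∀ j k, j < k → k ≤ m → γ < (s k : ℝ) - s j := by
    have : ∀ᶠ γ in 𝓝[>] (0 : ℝ), ∀ k ∈ Finset.range (m + 1), ∀ j ∈ Finset.range k,
        γ < (s k : ℝ) - s j := by
      rw [Filter.eventually_all_finset]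
      intro k hk
      rw [Filter.eventually_all_finset]
      intro j hj
      refine nhdsWithin_le_nhds (gt_mem_nhds (sub_pos.2 ?_))
      exact_mod_cast hs j k (Finset.mem_range.1 hj) (Nat.lt_succ_iff.1 (Finset.mem_range.1 hk))
    obtain ⟨γ, h, hγ⟩ := (this.and self_mem_nhdsWithin).exists
    exact ⟨γ, hγ, fun j k hjk hk => h k (Finset.mem_range.2 (by omega)) j (Finset.mem_range.2 hjk)⟩
  obtain ⟨γ, hγ, hgap⟩ := hgap
  set η := min (γ / 4) (ε / 2) with hη
  have hη0 : 0 < η := by positivity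
  have hη1 : η ≤ γ / 4 := min_le_left _ _
  have hη2 : η < ε := (min_le_right _ _).trans_lt (half_lt_self hε)
  refine ⟨η, hη0, fun s' hs'0 hs' => ?_⟩
  have hinj : Set.InjOn s (Set.Iic m) := by
    intro j hj k hk hjk
    rcases lt_trichotomy j k with h | h | h
    · exact absurd hjk (hs j k h hk).ne
    · exact h
    · exact absurd hjk (hs k j h hj).ne'
  let D : ℝ≥0 → ℝ := fun x => (s' (Function.invFunOn s (Set.Iic m) x) : ℝ) - x
  have hD : ∀ k ≤ m, D (s k) = s' k - s k := fun k hk => by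
    have : Function.invFunOn s (Set.Iic m) (s k) = k := hinj.leftInvOn_invFunOn hk
    simp only [D, this]
  have hs'' : ∀ k ≤ m, |(s' k : ℝ) - s k| < η := fun k hk => by
    have := hs' k hk
    rwa [NNReal.dist_eq] at this
  have hDlip : LipschitzOnWith (1 / 2) D (s '' Set.Iic m) := by
    refine LipschitzOnWith.of_dist_le_mul ?_
    rintro _ ⟨j, hj, rfl⟩ _ ⟨k, hk, rfl⟩
    rw [hD j hj, hD k hk, Real.dist_eq, NNReal.dist_eq]
    push_cast
    have h1 := abs_lt.1 (hs'' j hj)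
    have h2 := abs_lt.1 (hs'' k hk)
    rcases lt_trichotomy j k with h | h | h
    · have h3 := hgap j k h hk
      rw [abs_of_neg (show (s j : ℝ) - s k < 0 by linarith), abs_le]
      constructor <;> linarith
    · simp [h]
    · have h3 := hgap k j h hj
      rw [abs_of_pos (show (0 : ℝ) < s j - s k by linarith), abs_le]
      constructor <;> linarith
  obtain ⟨g, hg, hDg⟩ := hDlip.extend_real
  let φ : ℝ≥0 → ℝ := fun t => max (-η) (min η (g t))
  have hφlip : LipschitzWith (1 / 2) φ := (hg.const_min η).const_max (-η)
  have hφη : ∀ t, |φ t| ≤ η := fun t =>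
    abs_le.2 ⟨le_max_left _ _, max_le (by linarith) (min_le_left _ _)⟩
  have hφs : ∀ k ≤ m, φ (s k) = s' k - s k := fun k hk => by
    have h1 := abs_lt.1 (hs'' k hk)
    simp only [φ]
    rw [← hDg ⟨k, hk, rfl⟩, hD k hk, min_eq_right h1.2.le, max_eq_right h1.1.le]
  have hφ0 : φ 0 = 0 := by
    have := hφs 0 (Nat.zero_le _)
    rwa [hs0, hs'0, sub_self] at this
  have hφd : ∀ t t' : ℝ≥0, t ≤ t' → |φ t' - φ t| ≤ 1 / 2 * ((t' : ℝ) - t) := fun t t' htt' => by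
    have := hφlip.dist_le_mul t' t
    rw [Real.dist_eq, NNReal.dist_eq, abs_of_nonneg (sub_nonneg.2 (NNReal.coe_le_coe.2 htt'))]
      at this
    simpa using this
  have hnn : ∀ t : ℝ≥0, (t : ℝ) / 2 ≤ t + φ t := fun t => by
    have h1 := (abs_le.1 (hφd 0 t zero_le)).1
    rw [hφ0, NNReal.coe_zero] at h1
    linarith
  let A : ℝ≥0 → ℝ≥0 := fun t => ⟨t + φ t, le_trans (by positivity) (hnn t)⟩
  have hA : ∀ t, (A t : ℝ) = t + φ t := fun t => rfl
  have hAmono : StrictMono A := fun t t' htt' => by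
    rw [← NNReal.coe_lt_coe, hA, hA]
    have h1 := (abs_le.1 (hφd t t' htt'.le)).1
    have h2 : (t : ℝ) < t' := htt'
    linarith
  have hAcont : Continuous A := by
    have := hφlip.continuous
    exact Continuous.subtype_mk (by fun_prop) _
  have hAsurj : Function.Surjective A := fun y => by
    have hA0 : A 0 ≤ y := by
      rw [← NNReal.coe_le_coe, hA, hφ0]
      simp
    have hA2 : y ≤ A (2 * y) := by
      rw [← NNReal.coe_le_coe, hA]
      have := hnn (2 * y)
      push_cast at this ⊢
      linarith
    obtain ⟨x, -, hx⟩ := intermediate_value_Icc (zero_le (a := 2 * y)) hAcont.continuousOn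
      ⟨hA0, hA2⟩
    exact ⟨x, hx⟩
  refine ⟨hAmono.orderIsoOfSurjective A hAsurj, fun t => ?_, fun k hk => ?_⟩
  · change dist (A t) t < ε
    rw [NNReal.dist_eq, hA, add_sub_cancel_left]
    exact (hφη t).trans_lt hη2
  · change A (s k) = s' k
    rw [← NNReal.coe_inj, hA, hφs k hk]
    ring

section Measurability

variable {Ω : Type*} [MeasurableSpace Ω] {N : ℝ≥0 → Ω → ℕ} {d : ℕ}

/-- When there are infinitely many arrivals, the path depends continuously, in the `J₁` topology,
on the arrival times and on the values of the path after each arrival. -/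
lemma eventually_rescaledMidPrice_mem (hN : IsCountingProcess N) (S₀ : Ω → ℝ) (a : Fin d → ℝ)
    (X : ℕ → Ω → Fin d) {n : ℕ} (hn : n ≠ 0) {U : Set SkorokhodSpace} (hU : IsOpen U) {ω : Ω}
    (hω : ∀ k, ∃ t, k ≤ N t ω) (hωU : rescaledMidPrice S₀ a X hN n ω ∈ U) :
    ∀ᶠ z : (ℕ → ℝ) × (ℕ → ℝ≥0) in
      𝓝 (fun k => (S₀ ω + ∑ i ∈ Finset.Icc 1 k, a (X i ω)) / n, fun k => arrivalTime N k ω),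
      ∀ ω', (∀ k, ∃ t, k ≤ N t ω') → (∀ k, (S₀ ω' + ∑ i ∈ Finset.Icc 1 k, a (X i ω')) / n = z.1 k) →
        (∀ k, arrivalTime N k ω' = z.2 k) → rescaledMidPrice S₀ a X hN n ω' ∈ U := by
  obtain ⟨T, ε, hε, hT⟩ := hU _ hωU
  have hn0 : (0 : ℝ≥0) < n := by exact_mod_cast Nat.pos_of_ne_zero hn
  set m := N (n * T) ω + 1 with hm
  obtain ⟨η, hη, H⟩ := exists_timeChange (m := m) (s := fun k => arrivalTime N k ω / n)
    (by simp [arrivalTime_zero]) (fun j k hjk _ => by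
      obtain ⟨t, ht⟩ := hω k
      exact div_lt_div_of_pos_right (hN.arrivalTime_lt_arrivalTime hjk ht) hn0) hε
  have hev1 : ∀ᶠ z : (ℕ → ℝ) × (ℕ → ℝ≥0) in
      𝓝 (fun k => (S₀ ω + ∑ i ∈ Finset.Icc 1 k, a (X i ω)) / n, fun k => arrivalTime N k ω),
      ∀ k ∈ Finset.range (m + 1),
        dist (z.1 k) ((S₀ ω + ∑ i ∈ Finset.Icc 1 k, a (X i ω)) / n) < ε := by
    rw [Filter.eventually_all_finset]
    intro k _
    have hc : Continuous fun z : (ℕ → ℝ) × (ℕ → ℝ≥0) => z.1 k := by fun_prop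
    exact hc.continuousAt.eventually (Metric.ball_mem_nhds _ hε)
  have hev2 : ∀ᶠ z : (ℕ → ℝ) × (ℕ → ℝ≥0) in
      𝓝 (fun k => (S₀ ω + ∑ i ∈ Finset.Icc 1 k, a (X i ω)) / n, fun k => arrivalTime N k ω),
      ∀ k ∈ Finset.range (m + 1), dist (z.2 k / n) (arrivalTime N k ω / n) < η := by
    rw [Filter.eventually_all_finset]
    intro k _
    have hc : Continuous fun z : (ℕ → ℝ) × (ℕ → ℝ≥0) => z.2 k / (n : ℝ≥0) := by fun_prop
    exact hc.continuousAt.eventually (Metric.ball_mem_nhds _ hη)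
  filter_upwards [hev1, hev2] with z hz1 hz2 ω' hω' hv hT'
  obtain ⟨α, hα, hαs⟩ := H (fun k => arrivalTime N k ω' / n) (by simp [arrivalTime_zero])
    fun k hk => by
      simp only [hT']
      exact hz2 k (Finset.mem_range.2 (by omega))
  refine hT ⟨α, hα, fun t ht => ?_⟩
  have hkm : N (n * t) ω + 1 ≤ m := by
    have := hN.mono ω (mul_le_mul_right ht (n : ℝ≥0))
    simp only at this
    omega
  obtain ⟨r, hr⟩ := hω (N (n * t) ω + 1)
  obtain ⟨r', hr'⟩ := hω' (N (n * t) ω + 1)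
  -- Both paths have made the same number of jumps, at time `t` and at time `α t`.
  have hcount : N (n * α t) ω' = N (n * t) ω := by
    refine le_antisymm (Nat.lt_succ_iff.1 (not_le.1 fun hlt => ?_)) ?_
    · have h1 := (hN.arrivalTime_le_iff hr' (n * α t)).2 hlt
      rw [← div_le_iff₀' hn0, ← hαs _ hkm, α.le_iff_le, div_le_iff₀' hn0,
        hN.arrivalTime_le_iff hr] at h1
      omega
    · rw [← hN.arrivalTime_le_iff ((Nat.le_succ _).trans hr'), ← div_le_iff₀' hn0,
        ← hαs _ ((Nat.le_succ _).trans hkm), α.le_iff_le, div_le_iff₀' hn0]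
      exact arrivalTime_le le_rfl
  change dist ((S₀ ω' + ∑ k ∈ Finset.Icc 1 (N (n * α t) ω'), a (X k ω')) / n)
    ((S₀ ω + ∑ k ∈ Finset.Icc 1 (N (n * t) ω), a (X k ω)) / n) < ε
  rw [hcount, hv]
  exact hz1 _ (Finset.mem_range.2 (by omega))

lemma aemeasurable_rescaledMidPrice {P : Measure Ω} (hN : IsCountingProcess N)
    (hinf : ∀ᵐ ω ∂P, ∀ k, ∃ t, k ≤ N t ω) {S₀ : Ω → ℝ} (hS₀ : Measurable S₀) (a : Fin d → ℝ)
    {X : ℕ → Ω → Fin d} (hX : ∀ k, Measurable (X k)) (n : ℕ) :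
    AEMeasurable (rescaledMidPrice S₀ a X hN n) P := by
  rcases eq_or_ne n 0 with rfl | hn
  · have : rescaledMidPrice S₀ a X hN 0 = fun _ => SkorokhodSpace.linear 0 := by
      ext ω
      refine Subtype.ext (funext fun t => ?_)
      simp [rescaledMidPrice, SkorokhodSpace.linear]
    rw [this]
    exact aemeasurable_const
  let Z : Ω → (ℕ → ℝ) × (ℕ → ℝ≥0) := fun ω =>
    (fun k => (S₀ ω + ∑ i ∈ Finset.Icc 1 k, a (X i ω)) / n, fun k => arrivalTime N k ω)
  have hZ : Measurable Z := by
    refine Measurable.prodMk (measurable_pi_lambda _ fun k => ?_)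
      (measurable_pi_lambda _ hN.measurable_arrivalTime)
    refine (hS₀.add (Finset.measurable_fun_sum _ fun i _ => ?_)).div_const _
    exact (measurable_of_finite a).comp (hX i)
  set Ω₀ : Set Ω := {ω | ∀ k, ∃ t, k ≤ N t ω} with hΩ₀
  have hΩ₀m : MeasurableSet Ω₀ := by
    have : Ω₀ = ⋂ k : ℕ, ⋃ j : ℕ, {ω | k ≤ N j ω} := by
      ext ω
      simp only [hΩ₀, Set.mem_ofPred_eq, Set.mem_iInter, Set.mem_iUnion]
      refine forall_congr' fun k => ⟨?_, fun ⟨j, hj⟩ => ⟨j, hj⟩⟩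
      rintro ⟨t, ht⟩
      obtain ⟨j, hj⟩ := exists_nat_ge t
      exact ⟨j, ht.trans (hN.mono ω hj)⟩
    rw [this]
    exact MeasurableSet.iInter fun k => MeasurableSet.iUnion fun j =>
      measurableSet_le measurable_const (hN.measurable j)
  rw [← Measure.restrict_eq_self_of_ae_mem (s := Ω₀) hinf]
  refine aemeasurable_restrict_of_measurable_subtype hΩ₀m (measurable_of_isOpen fun U hU => ?_)
  -- On `Ω₀`, membership of the path in `U` is decided by the open set `G` of parameters.
  let G : Set ((ℕ → ℝ) × (ℕ → ℝ≥0)) := {z | ∀ᶠ z' in 𝓝 z, ∀ ω', (∀ k, ∃ t, k ≤ N t ω') →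
    (∀ k, (S₀ ω' + ∑ i ∈ Finset.Icc 1 k, a (X i ω')) / n = z'.1 k) →
    (∀ k, arrivalTime N k ω' = z'.2 k) → rescaledMidPrice S₀ a X hN n ω' ∈ U}
  have hG : IsOpen G := isOpen_setOfPred_eventually_nhds
  have : (fun ω : Ω₀ => rescaledMidPrice S₀ a X hN n ω) ⁻¹' U = (fun ω : Ω₀ => Z ω) ⁻¹' G := by
    ext ω
    refine ⟨fun h => eventually_rescaledMidPrice_mem hN S₀ a X hn hU ω.2 h, fun h => ?_⟩
    exact h.self_of_nhds ω.1 ω.2 (fun _ => rfl) fun _ => rfl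
  rw [this]
  exact (hZ.comp measurable_subtype_coe) hG.measurableSet

end Measurability

/-! ### Convergence in distribution to a linear path -/

/-- Locally uniform convergence in probability to a linear path implies convergence in
distribution for the `J₁` topology. -/
lemma tendstoInDistribution_linear {Ω : Type*} [MeasurableSpace Ω] {P : Measure Ω}
    [IsProbabilityMeasure P] {Y : ℕ → Ω → SkorokhodSpace} (hY : ∀ n, AEMeasurable (Y n) P) (c : ℝ)
    (h : ∀ (T : ℝ≥0) (ε : ℝ), 0 < ε →
      Tendsto (fun n => P.real {ω | ∃ t ≤ T, ε ≤ dist ((Y n ω).1 t) (c * t)}) atTop (𝓝 0)) :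
    TendstoInDistribution Y atTop (fun _ : Ω => SkorokhodSpace.linear c) (fun _ => P) P where
  forall_aemeasurable := hY
  aemeasurable_limit := aemeasurable_const
  tendsto := by
    refine ProbabilityMeasure.tendsto_iff_forall_integral_tendsto.2 fun f => ?_
    have hfm : Measurable f := f.continuous.measurable
    simp only [ProbabilityMeasure.coe_mk]
    rw [integral_map aemeasurable_const hfm.aestronglyMeasurable]
    simp only [integral_map (hY _) hfm.aestronglyMeasurable]
    simp only [integral_const, probReal_univ, smul_eq_mul, one_mul]
    refine Metric.tendsto_atTop'.2 fun δ hδ => ?_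
    have hopen : IsOpen (f ⁻¹' Metric.ball (f (SkorokhodSpace.linear c)) (δ / 2)) :=
      Metric.isOpen_ball.preimage f.continuous
    obtain ⟨T, ε, hε, hsub⟩ := hopen _ (Metric.mem_ball_self (half_pos hδ))
    set A : ℕ → Set Ω := fun n => {ω | ∃ t ≤ T, ε ≤ dist ((Y n ω).1 t) (c * t)} with hA
    have hlim : Tendsto (fun n => 2 * ‖f‖ * P.real (A n)) atTop (𝓝 0) := by
      simpa using (h T ε hε).const_mul (2 * ‖f‖)
    obtain ⟨n₀, hn₀⟩ := eventually_atTop.1 (hlim.eventually (gt_mem_nhds (half_pos hδ)))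
    refine ⟨n₀, fun n hn => ?_⟩
    have hpt : ∀ ω, ‖f (Y n ω) - f (SkorokhodSpace.linear c)‖ ≤
        δ / 2 + (toMeasurable P (A n)).indicator (fun _ => 2 * ‖f‖) ω := by
      intro ω
      by_cases hω : ω ∈ A n
      · rw [Set.indicator_of_mem (subset_toMeasurable P _ hω)]
        have := f.dist_le_two_norm (Y n ω) (SkorokhodSpace.linear c)
        rw [dist_eq_norm] at this
        linarith
      · have hmem : Y n ω ∈ SkorokhodSpace.basicNhd (SkorokhodSpace.linear c) T ε := by
          refine ⟨OrderIso.refl _, fun t => by simpa using hε, fun t ht => ?_⟩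
          by_contra! hcon
          exact hω ⟨t, ht, hcon⟩
        have h1 := hsub hmem
        rw [Set.mem_preimage, Metric.mem_ball, dist_eq_norm] at h1
        have h2 : 0 ≤ (toMeasurable P (A n)).indicator (fun _ => 2 * ‖f‖) ω :=
          Set.indicator_nonneg (fun _ _ => by positivity) _
        linarith
    have hfi : Integrable (fun ω => f (Y n ω)) P :=
      Integrable.of_bound (hfm.comp_aemeasurable (hY n)).aestronglyMeasurable ‖f‖
        (ae_of_all _ fun ω => f.norm_coe_le_norm _)
    have hind : Integrable ((toMeasurable P (A n)).indicator fun _ => 2 * ‖f‖) P :=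
      (integrable_const _).indicator (measurableSet_toMeasurable _ _)
    rw [dist_eq_norm]
    calc ‖∫ ω, f (Y n ω) ∂P - f (SkorokhodSpace.linear c)‖
        = ‖∫ ω, (f (Y n ω) - f (SkorokhodSpace.linear c)) ∂P‖ := by
          rw [integral_sub hfi (integrable_const _)]
          simp
      _ ≤ ∫ ω, ‖f (Y n ω) - f (SkorokhodSpace.linear c)‖ ∂P := norm_integral_le_integral_norm _
      _ ≤ ∫ ω, (δ / 2 + (toMeasurable P (A n)).indicator (fun _ => 2 * ‖f‖) ω) ∂P :=
          integral_mono (hfi.sub (integrable_const _)).norm ((integrable_const _).add hind) hpt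
      _ = δ / 2 + 2 * ‖f‖ * P.real (A n) := by
          rw [integral_add (integrable_const _) hind,
            integral_indicator_const _ (measurableSet_toMeasurable _ _), measureReal_def,
            measure_toMeasurable, ← measureReal_def]
          simp [mul_comm]
      _ < δ := by linarith [hn₀ n hn.le]

/-- A fixed random variable is negligible on the scale `n`. -/
lemma tendsto_measureReal_mul_lt_abs {Ω : Type*} [MeasurableSpace Ω] {P : Measure Ω}
    [IsProbabilityMeasure P] {S : Ω → ℝ} (hS : Measurable S) {ε : ℝ} (hε : 0 < ε) :
    Tendsto (fun n : ℕ => P.real {ω | ε * n < |S ω|}) atTop (𝓝 0) := by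
  have hempty : ⋂ n : ℕ, {ω | ε * n < |S ω|} = ∅ := by
    ext ω
    simp only [Set.mem_iInter, Set.mem_ofPred_eq, Set.mem_empty_iff_false, iff_false, not_forall,
      not_lt]
    obtain ⟨n, hn⟩ := exists_nat_ge (|S ω| / ε)
    exact ⟨n, (div_le_iff₀' hε).1 hn⟩
  have h := tendsto_measure_iInter_atTop (μ := P) (s := fun n : ℕ => {ω | ε * n < |S ω|})
    (fun n => (measurableSet_lt measurable_const hS.abs).nullMeasurableSet)
    (fun m n hmn ω hω => by
      simp only [Set.mem_ofPred_eq] at hω ⊢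
      refine lt_of_le_of_lt ?_ hω
      gcongr) ⟨0, measure_ne_top _ _⟩
  rw [hempty, measure_empty] at h
  exact (ENNReal.tendsto_toReal ENNReal.zero_ne_top).comp h

/-! ### The functional law of large numbers for the mid-price -/

theorem mainTheorem3 {Ω : Type*} [MeasurableSpace Ω] (P : Measure Ω) [IsProbabilityMeasure P]
    -- the Hawkes process
    (lam : ℝ) (hlam : 0 < lam) (μ : ℝ → ℝ) (hμ_meas : Measurable μ)
    (hμ_nonneg : ∀ s, 0 ≤ s → 0 ≤ μ s) (hμ_int : IntegrableOn μ (Set.Ioi 0))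
    (hμ_lt : ∫ s in Set.Ioi (0 : ℝ), μ s < 1)
    (N : ℝ≥0 → Ω → ℕ) (hN : IsHawkesProcess lam μ N P)
    -- the Markov chain with its stationary distribution
    {d : ℕ} (Q : Matrix (Fin d) (Fin d) ℝ) (hQ : Q.IsIrreducible)
    (X : ℕ → Ω → Fin d) (hX : IsMarkovChain Q X P)
    (π : Fin d → ℝ) (hπ : π ∈ stdSimplex ℝ (Fin d)) (hπQ : π ᵥ* Q = π)
    (hindep : IndepFun (fun ω k => X k ω) (fun ω t => N t ω) P)
    -- the mid-price process
    (a : Fin d → ℝ) (S₀ : Ω → ℝ) (hS₀ : Measurable S₀) :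
    TendstoInDistribution (fun n : ℕ => rescaledMidPrice S₀ a X hN.counting n) atTop
      (fun _ : Ω => SkorokhodSpace.linear
        ((∑ i, π i * a i) * (lam / (1 - ∫ s in Set.Ioi (0 : ℝ), μ s))))
      (fun _ => P) P := by

  have hp : 0 < 1 - ∫ s in Set.Ioi (0 : ℝ), μ s := by linarith
  have hinf := hN.ae_exists_le hlam hμ_nonneg hμ_int hμ_lt
  have hHawkes := fun T ε (hε : 0 < ε) =>
    hN.tendsto_measureReal_exists hlam.le hμ_nonneg hμ_int hμ_lt T (ε := ε) hε
  set ρ := lam / (1 - ∫ s in Set.Ioi (0 : ℝ), μ s) with hρ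
  have hρ0 : 0 < ρ := by positivity
  set A := ∑ i, π i * a i with hA
  refine tendstoInDistribution_linear
    (aemeasurable_rescaledMidPrice hN.counting hinf hS₀ a hX.measurable) (A * ρ) fun T ε hε => ?_
  set ε' := min 1 (ε / (4 * (|A| + 1))) with hε'
  have hε'0 : 0 < ε' := by positivity
  have hAε' : |A| * ε' ≤ ε / 4 := by
    calc |A| * ε' ≤ (|A| + 1) * (ε / (4 * (|A| + 1))) := by
          gcongr
          · linarith
          · exact min_le_right _ _
      _ = ε / 4 := by field_simp
  have h1 := tendsto_measureReal_mul_lt_abs (P := P) hS₀ (ε := ε / 4) (by positivity)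
  have h2 := hX.tendsto_measureReal_exists hQ hπ hπQ a (K := ρ * T + 1) (by positivity)
    (ε := ε / 4) (by positivity)
  have h3 := hHawkes T ε' hε'0
  have hsum := (h1.add h2).add h3
  simp only [add_zero] at hsum
  refine tendsto_of_tendsto_of_tendsto_of_le_of_le' tendsto_const_nhds hsum
    (Eventually.of_forall fun _ => measureReal_nonneg) ?_
  filter_upwards [eventually_ge_atTop 1] with n hn
  have hn0 : (0 : ℝ) < n := by exact_mod_cast hn
  refine le_trans (measureReal_mono ?_ (measure_ne_top _ _)) ((measureReal_union_le _ _).trans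
    (add_le_add_left (measureReal_union_le _ _) _))
  rintro ω ⟨t, htT, ht⟩
  by_contra hcon
  simp only [Set.mem_union, Set.mem_ofPred_eq, not_or, not_lt, not_exists, not_and] at hcon
  obtain ⟨⟨hS, hB⟩, hNt⟩ := hcon
  have hNt := hNt t htT
  have htT' : (t : ℝ) ≤ T := htT
  -- `N(nt)` stays in the range of indices over which the chain is controlled.
  have hrange : (N (n * t) ω : ℝ) ≤ (ρ * T + 1) * n := by
    have e1 := (abs_le.1 hNt).2
    have e2 : ε' * n ≤ 1 * n := by gcongr; exact min_le_left _ _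
    have e3 : ρ * (n * t) ≤ ρ * (n * T) := by gcongr
    linarith
  have hB := hB _ hrange
  have hsplit : (rescaledMidPrice S₀ a X hN.counting n ω).1 t - A * ρ * t =
      (S₀ ω + ∑ k ∈ Finset.Icc 1 (N (n * t) ω), (a (X k ω) - A) +
        A * (N (n * t) ω - ρ * (n * t))) / n := by
    change (S₀ ω + ∑ k ∈ Finset.Icc 1 (N (n * t) ω), a (X k ω)) / n - A * ρ * t = _
    rw [Finset.sum_sub_distrib]
    simp only [Finset.sum_const, Nat.card_Icc, add_tsub_cancel_right, nsmul_eq_mul]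
    field_simp
    ring
  rw [Real.dist_eq, hsplit, abs_div, abs_of_pos hn0, le_div_iff₀ hn0] at ht
  have hAN : |A * (N (n * t) ω - ρ * (n * t))| ≤ ε / 4 * n := by
    rw [abs_mul]
    calc _ ≤ |A| * (ε' * n) := by gcongr
      _ = |A| * ε' * n := by ring
      _ ≤ ε / 4 * n := by gcongr
  have htri := abs_add_three (S₀ ω) (∑ k ∈ Finset.Icc 1 (N (n * t) ω), (a (X k ω) - A))
    (A * (N (n * t) ω - ρ * (n * t)))
  have : 0 < ε * n := by positivity
  linarith
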